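/- Let $U$ be a permutation matrix (in the product computational basis) on $\mathbb{C}^{d_A}\otimes\mathbb{C}^{d_B}$, shared by two parties $A$ and $B$, and let $r$ be its operator Schmidt rank, i.e. $U=\sum_{j=1}^r A_j\otimes B_j$ with $A_1,\dots,A_r$ linearly independent $d_A\times d_A$ matrices and $B_1,\dots,B_r$ linearly independent $d_B\times d_B$ matrices. Put $M=\min\{d_A^2,\,d_B^2,\,d_A r,\,d_B r,\,2^r\}$. (i) With a one-qubit ancilla on one party and a two-qubit ancilla on the other (for either choice of which party holds which), all ancilla qubits starting and ending in $|0\rangle$, $U$ can be implemented exactly by a product of local permutation gates (permutations of the computational basis of one party's system together with its ancilla qubits) and at most $6M$ bipartite CNOT gates, each acting between a qubit of $A$ and a qubit of $B$, with either one as the control. (ii) Alternatively, with one ancilla qubit on either party (whichever one chooses), starting and ending in $|0\rangle$, $U$ can be implemented exactly and deterministically by local operations and classical communication (LOCC) consuming at most $3M$ ebits, i.e. shared two-qubit states $(|00\rangle+|11\rangle)/\sqrt2$. -/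

import Mathlib

open scoped Kronecker Matrix

namespace BipartiteCost

/-- `U = ∑_{j=1}^r A_j ⊗ B_j` with linearly independent `A_j` and linearly independent `B_j`:
the operator Schmidt rank of `U` is `r`. -/
def HasSchmidtRank {dA dB : ℕ} (U : Matrix (Fin dA × Fin dB) (Fin dA × Fin dB) ℂ) (r : ℕ) : Prop :=
  ∃ (A : Fin r → Matrix (Fin dA) (Fin dA) ℂ) (B : Fin r → Matrix (Fin dB) (Fin dB) ℂ),
    LinearIndependent ℂ A ∧ LinearIndependent ℂ B ∧ U = ∑ j, A j ⊗ₖ B j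

/-- `U` is a permutation matrix in the product computational basis. -/
def IsPermutationUnitary {dA dB : ℕ}
    (U : Matrix (Fin dA × Fin dB) (Fin dA × Fin dB) ℂ) : Prop :=
  ∃ σ : Equiv.Perm (Fin dA × Fin dB), U = σ.permMatrix ℂ

/-- Labels of the computational basis of a register of `m` qubits. The label `0` is the
all-zero string, and addition in `Fin 2` is addition modulo two. -/
abbrev Qubits (m : ℕ) : Type := Fin m → Fin 2

/-- Labels of the computational basis of one party: a `d`-level system together with `m`
ancilla qubits. -/
abbrev Party (d m : ℕ) : Type := Fin d × Qubits m

/-! ### Circuits of bipartite CNOT gates and local permutation gates -/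

/-- The gates allowed in a circuit: permutations of the computational basis of one party
(its system and its ancilla qubits together), and CNOT gates between one ancilla qubit of one
party and one ancilla qubit of the other party, in either direction. -/
inductive Gate (dA dB mA mB : ℕ) : Type
  | localA (σ : Equiv.Perm (Party dA mA))
  | localB (σ : Equiv.Perm (Party dB mB))
  | cnotAB (control : Fin mA) (target : Fin mB)
  | cnotBA (control : Fin mB) (target : Fin mA)

/-- The operator `|t⟩ ↦ |f t⟩` on computational basis states. -/
def basisMap {ι : Type} [DecidableEq ι] (f : ι → ι) : Matrix ι ι ℂ :=
  Matrix.of fun s t => if s = f t then 1 else 0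

/-- The operator of a gate on the two parties. -/
def Gate.toMatrix {dA dB mA mB : ℕ} :
    Gate dA dB mA mB → Matrix (Party dA mA × Party dB mB) (Party dA mA × Party dB mB) ℂ
  | .localA σ => σ.permMatrix ℂ ⊗ₖ (1 : Matrix (Party dB mB) (Party dB mB) ℂ)
  | .localB σ => (1 : Matrix (Party dA mA) (Party dA mA) ℂ) ⊗ₖ σ.permMatrix ℂ
  | .cnotAB i j => basisMap fun s =>
      (s.1, (s.2.1, Function.update s.2.2 j (s.2.2 j + s.1.2 i)))
  | .cnotBA j i => basisMap fun s =>
      ((s.1.1, Function.update s.1.2 i (s.1.2 i + s.2.2 j)), s.2)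

/-- The number of bipartite CNOT gates that a gate contributes. -/
def Gate.cnotCost {dA dB mA mB : ℕ} : Gate dA dB mA mB → ℕ
  | .localA _ => 0
  | .localB _ => 0
  | .cnotAB _ _ => 1
  | .cnotBA _ _ => 1

/-- The state vector `ψ ⊗ |0…0⟩`, with all ancilla qubits of both parties in the state `|0⟩`. -/
def withAncillas {dA dB : ℕ} (mA mB : ℕ) (ψ : Fin dA × Fin dB → ℂ) :
    Party dA mA × Party dB mB → ℂ :=
  fun s => if s.1.2 = 0 ∧ s.2.2 = 0 then ψ (s.1.1, s.2.1) else 0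

/-- With `mA` ancilla qubits at `A` and `mB` ancilla qubits at `B`, all of them starting in `|0⟩`
and ending in `|0⟩`, the operator `U` is implemented by local permutation gates and at most `N`
bipartite CNOT gates. -/
def ImplementedByCNOTs {dA dB : ℕ} (U : Matrix (Fin dA × Fin dB) (Fin dA × Fin dB) ℂ)
    (mA mB N : ℕ) : Prop :=
  ∃ c : List (Gate dA dB mA mB), (c.map Gate.cnotCost).sum ≤ N ∧
    ∀ ψ : Fin dA × Fin dB → ℂ,
      (c.map Gate.toMatrix).prod *ᵥ withAncillas mA mB ψ = withAncillas mA mB (U *ᵥ ψ)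

/-! ### Local operations and classical communication -/

/-- A projective measurement with outcomes `Fin n`. -/
structure IsProjectiveMeasurement {α : Type} [Fintype α] [DecidableEq α] {n : ℕ}
    (P : Fin n → Matrix α α ℂ) : Prop where
  hermitian : ∀ i, (P i).IsHermitian
  idempotent : ∀ i, P i * P i = P i
  orthogonal : ∀ i j, i ≠ j → P i * P j = 0
  complete : ∑ i, P i = 1

/-- Finite LOCC protocols of two parties whose registers have basis labels `α` and `β`. In each
step one party applies a unitary to its registers, or performs a projective measurement on them
and announces the outcome, on which everything that follows may depend. No further registers are
available. -/
inductive LOCC (α β : Type) [Fintype α] [DecidableEq α] [Fintype β] [DecidableEq β] : Type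
  | done : LOCC α β
  | unitaryA (V : Matrix.unitaryGroup α ℂ) (next : LOCC α β) : LOCC α β
  | unitaryB (V : Matrix.unitaryGroup β ℂ) (next : LOCC α β) : LOCC α β
  | measureA (n : ℕ) (P : Fin n → Matrix α α ℂ) (hP : IsProjectiveMeasurement P)
      (next : Fin n → LOCC α β) : LOCC α β
  | measureB (n : ℕ) (P : Fin n → Matrix β β ℂ) (hP : IsProjectiveMeasurement P)
      (next : Fin n → LOCC α β) : LOCC α β

/-- The action of a protocol on states, summed over all measurement outcomes. -/
noncomputable def LOCC.run {α β : Type} [Fintype α] [DecidableEq α] [Fintype β] [DecidableEq β] :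
    LOCC α β → Matrix (α × β) (α × β) ℂ → Matrix (α × β) (α × β) ℂ
  | .done, ρ => ρ
  | .unitaryA V next, ρ =>
      next.run ((V.1 ⊗ₖ (1 : Matrix β β ℂ)) * ρ * (V.1 ⊗ₖ (1 : Matrix β β ℂ))ᴴ)
  | .unitaryB V next, ρ =>
      next.run (((1 : Matrix α α ℂ) ⊗ₖ V.1) * ρ * ((1 : Matrix α α ℂ) ⊗ₖ V.1)ᴴ)
  | .measureA _ P _ next, ρ =>
      ∑ i, (next i).run ((P i ⊗ₖ (1 : Matrix β β ℂ)) * ρ * (P i ⊗ₖ (1 : Matrix β β ℂ))ᴴ)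
  | .measureB _ P _ next, ρ =>
      ∑ i, (next i).run (((1 : Matrix α α ℂ) ⊗ₖ P i) * ρ * ((1 : Matrix α α ℂ) ⊗ₖ P i)ᴴ)

/-- The density matrix of one ebit, `|Φ⟩⟨Φ|` with `|Φ⟩ = (|00⟩ + |11⟩)/√2`. -/
noncomputable def ebit : Matrix (Fin 2 × Fin 2) (Fin 2 × Fin 2) ℂ :=
  Matrix.of fun s t => if s.1 = s.2 ∧ t.1 = t.2 then 1 / 2 else 0

/-- The density matrix of `k` ebits shared between two registers of `k` qubits each. -/
noncomputable def ebits (k : ℕ) : Matrix (Qubits k × Qubits k) (Qubits k × Qubits k) ℂ :=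
  Matrix.of fun s t => ∏ i, ebit (s.1 i, s.2 i) (t.1 i, t.2 i)

/-- The state `ρ` together with `k` ebits, each party holding one half of every ebit. -/
noncomputable def addEbits {α β : Type} (k : ℕ) (ρ : Matrix (α × β) (α × β) ℂ) :
    Matrix ((α × Qubits k) × (β × Qubits k)) ((α × Qubits k) × (β × Qubits k)) ℂ :=
  Matrix.of fun s t =>
    ρ (s.1.1, s.2.1) (t.1.1, t.2.1) * ebits k (s.1.2, s.2.2) (t.1.2, t.2.2)

/-- The partial trace over the qubits that held the `k` ebits. -/
def traceEbits {α β : Type} {k : ℕ}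
    (ρ : Matrix ((α × Qubits k) × (β × Qubits k)) ((α × Qubits k) × (β × Qubits k)) ℂ) :
    Matrix (α × β) (α × β) ℂ :=
  Matrix.of fun s t => ∑ e : Qubits k, ∑ f : Qubits k,
    ρ ((s.1, e), (s.2, f)) ((t.1, e), (t.2, f))

/-- The state `ρ ⊗ |0…0⟩⟨0…0|`, with all ancilla qubits of both parties in the state `|0⟩`. -/
def withAncillasState {dA dB : ℕ} (mA mB : ℕ) (ρ : Matrix (Fin dA × Fin dB) (Fin dA × Fin dB) ℂ) :
    Matrix (Party dA mA × Party dB mB) (Party dA mA × Party dB mB) ℂ :=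
  Matrix.of fun s t =>
    if (s.1.2 = 0 ∧ s.2.2 = 0) ∧ (t.1.2 = 0 ∧ t.2.2 = 0)
    then ρ (s.1.1, s.2.1) (t.1.1, t.2.1) else 0

/-- With `mA` ancilla qubits at `A` and `mB` ancilla qubits at `B`, all of them starting in `|0⟩`
and ending in `|0⟩`, the operator `U` is implemented by LOCC and at most `N` ebits. The protocol is
deterministic and exact. As both sides are linear in `ρ`, to range over all matrices `ρ` amounts to
ranging over all density matrices, also those of systems entangled with a reference. -/
def ImplementedByLOCC {dA dB : ℕ} (U : Matrix (Fin dA × Fin dB) (Fin dA × Fin dB) ℂ)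
    (mA mB N : ℕ) : Prop :=
  ∃ k : ℕ, k ≤ N ∧ ∃ p : LOCC (Party dA mA × Qubits k) (Party dB mB × Qubits k),
    ∀ ρ : Matrix (Fin dA × Fin dB) (Fin dA × Fin dB) ℂ,
      traceEbits (p.run (addEbits k (withAncillasState mA mB ρ))) =
        withAncillasState mA mB (U * ρ * Uᴴ)

/-- `min {dA², dB², dA r, dB r, 2^r}`. -/
def costBound (dA dB r : ℕ) : ℕ :=
  min (dA ^ 2) (min (dB ^ 2) (min (dA * r) (min (dB * r) (2 ^ r))))

end BipartiteCost

/-! Let `g` be the permutation of basis pairs that `U` performs, seen as a matrix of blocks: block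
`(i, j)` is the partial injection `b ↦ b'` with `g (i, b) = (j, b')`. Colour each pair by the block
that moves it, as a set and regardless of its position. A colour class is then a rectangle `D × E`
on which `g` is a product of two injections (`isRectangular_blockColour`).

The number of colours is the number of distinct nonempty blocks. It is at most `dA ^ 2`, the number
of positions. It is at most `dA * r`, since a factorisation of an identity matrix through dimension
`r` leaves at most `r` nonempty blocks in a row. It is at most `2 ^ r`, since in an operator space
of dimension at most `r` that many entries determine a block, and they are 0 or 1. Exchanging the
parties gives the bounds with `dB`, so one of the two colourings has at most `M` colours.

One flag bit records which pairs have been moved. Three controlled permutations treat one colour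
(`IsRectangular.exists_layered_colour`), so `g` costs at most `3 M` controlled permutations
(`Layered`) besides local ones. A controlled permutation with a one-bit control costs two CNOTs, to
copy the bit to the other party and to erase it (`Layered.exists_circuit`), or one ebit, with
measurements and a phase correction instead of the erasure (`IsFresh.realizes_condRight`). -/

namespace BipartiteCost

/-! ### Products of local permutations and controlled permutations -/

section Layered

variable {X Y X' Y' : Type}

/-- Apply `θ` to the second component if the first one satisfies `q`. -/
def condRight (q : X → Bool) (θ : Equiv.Perm Y) : Equiv.Perm (X × Y) :=
  Equiv.prodShear (Equiv.refl X) fun x => if q x then θ else 1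

/-- Apply `θ` to the first component if the second one satisfies `q`. -/
def condLeft (q : Y → Bool) (θ : Equiv.Perm X) : Equiv.Perm (X × Y) :=
  (Equiv.prodComm Y X).permCongr (condRight q θ)

lemma condRight_apply (q : X → Bool) (θ : Equiv.Perm Y) (s : X × Y) :
    condRight q θ s = (s.1, if q s.1 then θ s.2 else s.2) := by
  cases h : q s.1 <;> simp [condRight, h]

lemma condLeft_apply (q : Y → Bool) (θ : Equiv.Perm X) (s : X × Y) :
    condLeft q θ s = (if q s.2 then θ s.1 else s.1, s.2) := by
  simp [condLeft, condRight_apply, Equiv.permCongr_apply]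

/-- `Layered n p`: the permutation `p` is a product of permutations of one component and `n`
permutations of one component controlled by the other. -/
inductive Layered : ℕ → Equiv.Perm (X × Y) → Prop
  | one : Layered 0 1
  | mulLeft {n : ℕ} {p : Equiv.Perm (X × Y)} (hp : Layered n p) (θ : Equiv.Perm X) :
      Layered n (p * condLeft (fun _ => true) θ)
  | mulRight {n : ℕ} {p : Equiv.Perm (X × Y)} (hp : Layered n p) (θ : Equiv.Perm Y) :
      Layered n (p * condRight (fun _ => true) θ)
  | mulCondLeft {n : ℕ} {p : Equiv.Perm (X × Y)} (hp : Layered n p) (q : Y → Bool)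
      (θ : Equiv.Perm X) : Layered (n + 1) (p * condLeft q θ)
  | mulCondRight {n : ℕ} {p : Equiv.Perm (X × Y)} (hp : Layered n p) (q : X → Bool)
      (θ : Equiv.Perm Y) : Layered (n + 1) (p * condRight q θ)

lemma Layered.mul {n m : ℕ} {p p' : Equiv.Perm (X × Y)} (hp : Layered n p)
    (hp' : Layered m p') : Layered (n + m) (p * p') := by
  induction hp' with
  | one => simpa using hp
  | mulLeft _ θ ih => simpa only [mul_assoc] using ih.mulLeft θ
  | mulRight _ θ ih => simpa only [mul_assoc] using ih.mulRight θ
  | mulCondLeft _ q θ ih => simpa only [mul_assoc, add_assoc] using ih.mulCondLeft q θ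
  | mulCondRight _ q θ ih => simpa only [mul_assoc, add_assoc] using ih.mulCondRight q θ

/-- The generators are symmetric in the two components, so a flag placed at one party can be moved
to the other at equal cost. -/
lemma Layered.permCongr_prodComm {n : ℕ} {p : Equiv.Perm (X × Y)} (hp : Layered n p) :
    Layered n ((Equiv.prodComm X Y).permCongr p) := by
  have key : ∀ p p' : Equiv.Perm (X × Y), (Equiv.prodComm X Y).permCongr (p * p') =
      (Equiv.prodComm X Y).permCongr p * (Equiv.prodComm X Y).permCongr p' :=
    fun p p' => by ext s : 1; simp [Equiv.permCongr_apply]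
  have hl : ∀ (q : Y → Bool) (θ : Equiv.Perm X),
      (Equiv.prodComm X Y).permCongr (condLeft q θ) = condRight q θ :=
    fun q θ => by ext s : 1; simp [Equiv.permCongr_apply, condLeft_apply, condRight_apply]
  have hr : ∀ (q : X → Bool) (θ : Equiv.Perm Y),
      (Equiv.prodComm X Y).permCongr (condRight q θ) = condLeft q θ :=
    fun q θ => by ext s : 1; simp [Equiv.permCongr_apply, condLeft_apply, condRight_apply]
  induction hp with
  | one =>
    convert Layered.one using 1
    ext s : 1
    simp [Equiv.permCongr_apply]
  | mulLeft _ θ ih => rw [key, hl]; exact ih.mulRight θ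
  | mulRight _ θ ih => rw [key, hr]; exact ih.mulLeft θ
  | mulCondLeft _ q θ ih => rw [key, hl]; exact ih.mulCondRight q θ
  | mulCondRight _ q θ ih => rw [key, hr]; exact ih.mulCondLeft q θ

lemma Layered.permCongr {n : ℕ} {p : Equiv.Perm (X × Y)} (hp : Layered n p)
    (e : X ≃ X') (e' : Y ≃ Y') : Layered n ((e.prodCongr e').permCongr p) := by
  have key : ∀ p p' : Equiv.Perm (X × Y), (e.prodCongr e').permCongr (p * p') =
      (e.prodCongr e').permCongr p * (e.prodCongr e').permCongr p' :=
    fun p p' => by ext s : 1; simp [Equiv.permCongr_apply]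
  have hl : ∀ (q : Y → Bool) (θ : Equiv.Perm X),
      (e.prodCongr e').permCongr (condLeft q θ) =
        condLeft (fun y => q (e'.symm y)) (e.permCongr θ) := fun q θ => by
    ext s : 1
    cases h : q (e'.symm s.2) <;> simp [Equiv.permCongr_apply, condLeft_apply, h]
  have hr : ∀ (q : X → Bool) (θ : Equiv.Perm Y),
      (e.prodCongr e').permCongr (condRight q θ) =
        condRight (fun x => q (e.symm x)) (e'.permCongr θ) := fun q θ => by
    ext s : 1
    cases h : q (e.symm s.1) <;> simp [Equiv.permCongr_apply, condRight_apply, h]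
  induction hp with
  | one =>
    convert Layered.one using 1
    ext ⟨x, y⟩ : 1
    simp [Equiv.permCongr_apply]
  | mulLeft _ θ ih => rw [key, hl]; exact ih.mulLeft _
  | mulRight _ θ ih => rw [key, hr]; exact ih.mulRight _
  | mulCondLeft _ q θ ih => rw [key, hl]; exact ih.mulCondLeft _ _
  | mulCondRight _ q θ ih => rw [key, hr]; exact ih.mulCondRight _ _

end Layered

/-! ### Permutations of a product whose colour classes are rectangles -/

section Rectangles

/-- An injective map on a set extends to a permutation that moves only points of the set and of
its image. -/
lemma exists_perm_extending {α : Type} [Finite α] (D : Set α) (f : α → α) (hf : Set.InjOn f D) :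
    ∃ π : Equiv.Perm α, (∀ a ∈ D, π a = f a) ∧ ∀ a, a ∉ D → a ∉ f '' D → π a = a := by
  classical
  induction D, D.toFinite using Set.Finite.induction_on with
  | empty => exact ⟨1, by simp, by simp⟩
  | @insert a s ha hs ih =>
    obtain ⟨π, h1, h2⟩ := ih (hf.mono (Set.subset_insert a s))
    -- The transposition corrects the value at `a`. Injectivity of `π` and of `f` keeps it away from
    -- the values already prescribed.
    refine ⟨Equiv.swap (π a) (f a) * π, ?_, ?_⟩
    · intro b hb
      rcases hb with rfl | hb
      · simp
      · have hba : b ≠ a := fun h => ha (h ▸ hb)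
        rw [Equiv.Perm.mul_apply, Equiv.swap_apply_of_ne_of_ne (by simpa using hba), h1 b hb]
        rw [h1 b hb]
        exact fun h => hba (hf (Or.inr hb) (Or.inl rfl) h)
    · intro b hb hb'
      have hba : b ≠ a := fun h => hb (Or.inl h)
      have hbf : b ≠ f a := fun h => hb' ⟨a, Or.inl rfl, h.symm⟩
      have hπ : π b = b := h2 b (fun h => hb (Or.inr h))
        (fun h => hb' (Set.image_mono (Set.subset_insert a s) h))
      rw [Equiv.Perm.mul_apply, Equiv.swap_apply_of_ne_of_ne (by simpa using hba), hπ]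
      rwa [hπ]

open Classical in
/-- The involution of `β × Fin 2` that exchanges `(b, 0)` and `(τ b, 1)` for `b ∈ E`. -/
noncomputable def flagSwap {β : Type} (E : Set β) (τ : Equiv.Perm β) :
    Equiv.Perm (β × Fin 2) :=
  Function.Involutive.toPerm
    (fun s => if s.2 = 0 then (if s.1 ∈ E then (τ s.1, 1) else s)
      else if τ.symm s.1 ∈ E then (τ.symm s.1, 0) else s)
    (by
      rintro ⟨b, f⟩
      fin_cases f
      · by_cases h : b ∈ E <;> simp [h]
      · by_cases h : τ.symm b ∈ E <;> simp [h])

open Classical in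
lemma flagSwap_apply {β : Type} (E : Set β) (τ : Equiv.Perm β) (s : β × Fin 2) :
    flagSwap E τ s = if s.2 = 0 then (if s.1 ∈ E then (τ s.1, 1) else s)
      else if τ.symm s.1 ∈ E then (τ.symm s.1, 0) else s := rfl

lemma flagSwap_zero_mem {β : Type} {E : Set β} (τ : Equiv.Perm β) {b : β} (hb : b ∈ E) :
    flagSwap E τ (b, 0) = (τ b, 1) := by simp [flagSwap_apply, hb]

lemma flagSwap_zero_notMem {β : Type} {E : Set β} (τ : Equiv.Perm β) {b : β} (hb : b ∉ E) :
    flagSwap E τ (b, 0) = (b, 0) := by simp [flagSwap_apply, hb]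

lemma flagSwap_one_mem {β : Type} {E : Set β} (τ : Equiv.Perm β) {b : β} (hb : τ.symm b ∈ E) :
    flagSwap E τ (b, 1) = (τ.symm b, 0) := by simp [flagSwap_apply, hb]

lemma flagSwap_one_notMem {β : Type} {E : Set β} (τ : Equiv.Perm β) {b : β}
    (hb : τ.symm b ∉ E) : flagSwap E τ (b, 1) = (b, 1) := by simp [flagSwap_apply, hb]

variable {α β κ : Type} [Finite α] [Finite β]

/-- Each colour class of `c` is a rectangle on which `g` is a product of injective maps. -/
def IsRectangular (g : Equiv.Perm (α × β)) (c : α × β → κ) : Prop :=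
  ∀ k, ∃ (D : Set α) (E : Set β) (f : α → α) (t : β → β), Set.InjOn f D ∧ Set.InjOn t E ∧
    (∀ a b, c (a, b) = k ↔ a ∈ D ∧ b ∈ E) ∧ ∀ a ∈ D, ∀ b ∈ E, g (a, b) = (f a, t b)

/-- Three controlled layers apply `g` to the pairs of one colour and raise the flag on them. -/
lemma IsRectangular.exists_layered_colour {g : Equiv.Perm (α × β)} {c : α × β → κ}
    (h : IsRectangular g c) (k : κ) :
    ∃ S : Equiv.Perm (α × (β × Fin 2)), Layered 3 S ∧
      (∀ a b, c (a, b) = k → S (a, (b, 0)) = ((g (a, b)).1, ((g (a, b)).2, 1))) ∧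
      ∀ a b, c (a, b) ≠ k → S (a, (b, 0)) = (a, (b, 0)) ∧
        S ((g (a, b)).1, ((g (a, b)).2, 1)) = ((g (a, b)).1, ((g (a, b)).2, 1)) := by
  classical
  obtain ⟨D, E, f, t, hf, ht, hc, hg⟩ := h k
  obtain ⟨π, hπ, hπ'⟩ := exists_perm_extending D f hf
  obtain ⟨τ, hτ, -⟩ := exists_perm_extending E t ht
  -- Read from right to left: rows in `D` exchange `(b, 0)` with `(τ b, 1)`, then `π` moves the
  -- flagged pairs. The first exchange also disturbs finished pairs whose row lies in `D` but not in
  -- `f '' D`; the last layer undoes exactly this. Finished pairs in rows outside both sets are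
  -- fixed by `π`.
  refine ⟨1 * condRight (fun a => decide (a ∈ D ∧ a ∉ f '' D)) (flagSwap E τ) *
    condLeft (fun s : β × Fin 2 => decide (τ.symm s.1 ∈ E ∧ s.2 = 1)) π *
    condRight (fun a => decide (a ∈ D)) (flagSwap E τ),
    ((Layered.one.mulCondRight _ _).mulCondLeft _ _).mulCondRight _ _, ?_, ?_⟩
  · intro a b hk
    obtain ⟨ha, hb⟩ := (hc a b).1 hk
    have hm : f a ∈ f '' D := ⟨a, ha, rfl⟩
    simp only [one_mul, Equiv.Perm.mul_apply, condRight_apply, condLeft_apply, ha,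
      flagSwap_zero_mem τ hb, decide_true, if_true, Equiv.symm_apply_apply, hb, hπ a ha,
      and_self, hm, not_true_eq_false, and_false, decide_false, hg a ha b hb, Bool.false_eq_true,
      if_false, ← hτ b hb]
  · intro a b hk
    rw [Ne, hc] at hk
    refine ⟨?_, ?_⟩
    · by_cases ha : a ∈ D
      · have hb : b ∉ E := fun hb => hk ⟨ha, hb⟩
        simp [Equiv.Perm.mul_apply, condRight_apply, condLeft_apply, flagSwap_zero_notMem τ hb]
      · simp [Equiv.Perm.mul_apply, condRight_apply, condLeft_apply, ha]
    · have hk' : ¬ ((g (a, b)).1 ∈ f '' D ∧ τ.symm (g (a, b)).2 ∈ E) := by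
        rintro ⟨⟨d, hd, hd'⟩, he⟩
        have h1 : g (d, τ.symm (g (a, b)).2) = g (a, b) := by
          rw [hg d hd _ he, ← hτ _ he, Equiv.apply_symm_apply, hd']
        obtain ⟨rfl, h3⟩ := Prod.mk.inj (g.injective h1)
        exact hk ⟨hd, h3 ▸ he⟩
      generalize g (a, b) = s at hk'
      obtain ⟨a', b'⟩ := s
      by_cases hb : τ.symm b' ∈ E
      · have ha' : a' ∉ f '' D := fun h => hk' ⟨h, hb⟩
        by_cases ha : a' ∈ D
        · simp only [one_mul, Equiv.Perm.mul_apply, condRight_apply, condLeft_apply, ha, ha',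
            flagSwap_one_mem τ hb, flagSwap_zero_mem τ hb, decide_true, if_true,
            Equiv.apply_symm_apply, not_false_eq_true, and_self, and_false, zero_ne_one,
            decide_false, Bool.false_eq_true, if_false]
        · simp only [one_mul, Equiv.Perm.mul_apply, condRight_apply, condLeft_apply, ha,
            decide_false, Bool.false_eq_true, if_false, hπ' a' ha ha', ite_self, false_and]
      · simp [Equiv.Perm.mul_apply, condRight_apply, condLeft_apply, flagSwap_one_notMem τ hb, hb]

/-- A permutation with a rectangular colouring is implemented by three controlled layers per
colour, with one flag bit that starts and ends in `0`. -/
lemma IsRectangular.exists_layered {g : Equiv.Perm (α × β)} {c : α × β → κ}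
    (h : IsRectangular g c) (K : Finset κ) (hK : ∀ s, c s ∈ K) :
    ∃ p : Equiv.Perm (α × (β × Fin 2)), Layered (3 * K.card) p ∧
      ∀ a b, p (a, (b, 0)) = ((g (a, b)).1, ((g (a, b)).2, 0)) := by
  classical
  -- Invariant: the flag is `1` exactly on the pairs whose colour has been treated.
  have aux : ∀ l : List κ, l.Nodup → ∃ p : Equiv.Perm (α × (β × Fin 2)),
      Layered (3 * l.length) p ∧ ∀ a b, p (a, (b, 0)) =
        if c (a, b) ∈ l then ((g (a, b)).1, ((g (a, b)).2, 1)) else (a, (b, 0)) := by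
    intro l hl
    induction l with
    | nil => exact ⟨1, Layered.one, by simp⟩
    | cons k l ih =>
      obtain ⟨hkl, hl⟩ := List.nodup_cons.1 hl
      obtain ⟨p, hp, hp'⟩ := ih hl
      obtain ⟨S, hS, hS1, hS2⟩ := h.exists_layered_colour k
      refine ⟨S * p, ?_, fun a b => ?_⟩
      · rw [List.length_cons, Nat.mul_add, Nat.add_comm]
        exact hS.mul hp
      · rw [Equiv.Perm.mul_apply, hp']
        by_cases hm : c (a, b) ∈ l
        · have hne : c (a, b) ≠ k := fun h => hkl (h ▸ hm)
          simp [hm, (hS2 a b hne).2]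
        · by_cases hk : c (a, b) = k
          · rw [if_neg hm, hS1 a b hk, if_pos (by simp [hk])]
          · simp [hm, hk, (hS2 a b hk).1]
  obtain ⟨p, hp, hp'⟩ := aux K.toList K.nodup_toList
  rw [Finset.length_toList] at hp
  -- Now every flag that started in `0` is `1`, and an uncontrolled flip, free of charge, resets it.
  refine ⟨1 * condRight (fun _ => true) ((Equiv.refl β).prodCongr (Equiv.swap 0 1)) * p,
    ?_, fun a b => ?_⟩
  · have := (Layered.one.mulRight ((Equiv.refl β).prodCongr (Equiv.swap (0 : Fin 2) 1))).mul
      (X := α) hp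
    rwa [Nat.zero_add] at this
  · simp [Equiv.Perm.mul_apply, hp', hK, condRight_apply]

end Rectangles

/-! ### Colouring by blocks, and the number of colours -/

section Blocks

variable {α β : Type} [Fintype α] [DecidableEq α] [Fintype β] [DecidableEq β]

/-- The operator of `g` as a matrix of operators on the second component: the support of the
block that takes `i` to `j`. -/
def block (g : Equiv.Perm (α × β)) (i j : α) : Finset (β × β) :=
  Finset.univ.filter fun s => g (i, s.1) = (j, s.2)

/-- The block by which a pair is transformed. -/
def blockColour (g : Equiv.Perm (α × β)) (s : α × β) : Finset (β × β) :=
  block g s.1 (g s).1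

omit [Fintype α] in
lemma mem_block {g : Equiv.Perm (α × β)} {i j : α} {s : β × β} :
    s ∈ block g i j ↔ g (i, s.1) = (j, s.2) := by simp [block]

/-- The block `k` alone determines the output at the second party, so it can be read off in any row
`a₀` that contains `k`. A row `a` containing `k` sends all of the domain of `k` to one output row,
which any `b₀` in that domain reveals. Injectivity of both factors is inherited from `g`. -/
lemma isRectangular_blockColour (g : Equiv.Perm (α × β)) :
    IsRectangular g (blockColour g) := by
  intro k
  by_cases hk : ∃ s, blockColour g s = k
  · obtain ⟨⟨a₀, b₀⟩, h₀⟩ := hk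
    have hmem : (b₀, (g (a₀, b₀)).2) ∈ k := by rw [← h₀]; simp [blockColour, mem_block]
    have hg : ∀ a, (∃ j, block g a j = k) → ∀ b, (∃ b', (b, b') ∈ k) →
        blockColour g (a, b) = k ∧ g (a, b) = ((g (a, b₀)).1, (g (a₀, b)).2) := by
      rintro a ⟨j, rfl⟩ b ⟨b', hb'⟩
      have h1 := mem_block.1 hb'
      have h2 := mem_block.1 hmem
      have h3 := mem_block.1 (h₀ ▸ hb')
      simp only at h1 h2 h3
      simp [blockColour, h1, h2, h3]
    refine ⟨{a | ∃ j, block g a j = k}, {b | ∃ b', (b, b') ∈ k}, fun a => (g (a, b₀)).1,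
      fun b => (g (a₀, b)).2, ?_, ?_, ?_, fun a ha b hb => (hg a ha b hb).2⟩
    · intro a ha a' ha' h
      have h1 := (hg a ha b₀ ⟨_, hmem⟩).2
      have h2 := (hg a' ha' b₀ ⟨_, hmem⟩).2
      simp only at h
      rw [h, ← h2] at h1
      exact (Prod.mk.inj (g.injective h1)).1
    · intro b hb b' hb' h
      have h1 := (hg a₀ ⟨_, h₀⟩ b hb).2
      have h2 := (hg a₀ ⟨_, h₀⟩ b' hb').2
      simp only at h
      rw [h, ← h2] at h1
      exact (Prod.mk.inj (g.injective h1)).2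
    · intro a b
      refine ⟨fun h => ⟨⟨_, h⟩, (g (a, b)).2, ?_⟩, fun h => (hg a h.1 b h.2).1⟩
      rw [← h]
      simp [blockColour, mem_block]
  · push Not at hk
    exact ⟨∅, ∅, id, id, by simp, by simp, fun a b => by simp [hk], by simp⟩

lemma card_image_blockColour_le_sq (g : Equiv.Perm (α × β)) :
    (Finset.univ.image (blockColour g)).card ≤ Fintype.card α ^ 2 := by
  have hsub : Finset.univ.image (blockColour g) ⊆
      Finset.univ.image fun s : α × α => block g s.1 s.2 := by
    intro k hk
    obtain ⟨s, -, rfl⟩ := Finset.mem_image.1 hk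
    exact Finset.mem_image.2 ⟨(s.1, (g s).1), Finset.mem_univ _, rfl⟩
  refine (Finset.card_le_card hsub).trans (Finset.card_image_le.trans ?_)
  simp [sq]

variable {r : ℕ} {g : Equiv.Perm (α × β)} {A : Fin r → Matrix α α ℂ} {B : Fin r → Matrix β β ℂ}

lemma card_image_blockColour_le_mul
    (h : ∀ s t, (if s = g t then 1 else 0 : ℂ) = ∑ l, A l s.1 t.1 * B l s.2 t.2) :
    (Finset.univ.image (blockColour g)).card ≤ Fintype.card α * r := by
  have hrow : ∀ i, (Finset.univ.image fun b => (g (i, b)).1).card ≤ r := by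
    intro i
    set S := Finset.univ.image fun b => (g (i, b)).1
    have hS : ∀ j : S, ∃ b, (g (i, b)).1 = j := fun j => by
      obtain ⟨b, -, hb⟩ := Finset.mem_image.1 j.2
      exact ⟨b, hb⟩
    choose b hb using hS
    -- One column `b j` per output row `j` suffices: the corresponding entries of `U` form an
    -- identity matrix, and the Schmidt decomposition factors it through dimension `r`.
    have h1 : (1 : Matrix S S ℂ) = (Matrix.of fun (j : S) l => A l j i) *
        (Matrix.of fun l (j : S) => B l (g (i, b j)).2 (b j)) := by
      ext j j'
      have := h ((j : α), (g (i, b j')).2) (i, b j')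
      simp only [Matrix.mul_apply, Matrix.of_apply, ← this, Matrix.one_apply]
      refine if_congr ?_ rfl rfl
      rw [Prod.ext_iff, hb j', Subtype.ext_iff]
      exact (and_iff_left rfl).symm
    have h2 := Matrix.rank_one (n := S) (R := ℂ)
    rw [h1, Fintype.card_coe] at h2
    rw [← h2]
    exact (Matrix.rank_mul_le_left _ _).trans
      (by simpa using Matrix.rank_le_card_width (Matrix.of fun (j : S) l => A l j i))
  have hsub : Finset.univ.image (blockColour g) ⊆ Finset.univ.biUnion fun i =>
      (Finset.univ.image fun b => (g (i, b)).1).image (block g i) := by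
    intro k hk
    obtain ⟨s, -, rfl⟩ := Finset.mem_image.1 hk
    simp only [Finset.mem_biUnion, Finset.mem_image, Finset.mem_univ, true_and]
    exact ⟨s.1, (g s).1, ⟨s.2, rfl⟩, rfl⟩
  refine (Finset.card_le_card hsub).trans (Finset.card_biUnion_le.trans ?_)
  refine (Finset.sum_le_sum fun i _ => Finset.card_image_le.trans (hrow i)).trans ?_
  simp

lemma card_image_blockColour_le_two_pow
    (h : ∀ s t, (if s = g t then 1 else 0 : ℂ) = ∑ l, A l s.1 t.1 * B l s.2 t.2) :
    (Finset.univ.image (blockColour g)).card ≤ 2 ^ r := by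
  classical
  -- `v s` lists the entry `s` of all blocks, as a function of the block's position. These functions
  -- span at most `r` dimensions.
  let v : β × β → α × α → ℂ := fun s u => if g (u.1, s.1) = (u.2, s.2) then 1 else 0
  have hv : ∀ s, v s ∈ Submodule.span ℂ (Set.range fun l (u : α × α) => A l u.2 u.1) := by
    intro s
    have : v s = ∑ l, B l s.2 s.1 • fun u : α × α => A l u.2 u.1 := by
      ext u
      have := h (u.2, s.2) (u.1, s.1)
      simp only [Finset.sum_apply, Pi.smul_apply, smul_eq_mul, v, eq_comm (a := g _), this]
      exact Finset.sum_congr rfl fun l _ => mul_comm _ _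
    rw [this]
    exact Submodule.sum_mem _ fun l _ => Submodule.smul_mem _ _ (Submodule.subset_span ⟨l, rfl⟩)
  obtain ⟨ι, a, ha, hspan, hli⟩ := exists_linearIndependent' ℂ v
  have : Fintype ι := Fintype.ofInjective a ha
  have hcard : Fintype.card ι ≤ r := by
    rw [← finrank_span_eq_card hli]
    refine (Submodule.finrank_mono (hspan.le.trans ?_)).trans
      ((finrank_range_le_card (R := ℂ) fun l (u : α × α) => A l u.2 u.1).trans_eq
        (Fintype.card_fin r))
    rw [Submodule.span_le]
    rintro _ ⟨s, rfl⟩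
    exact hv s
  have hinj : ∀ u u' : α × α, (∀ x, v (a x) u = v (a x) u') →
      block g u.1 u.2 = block g u'.1 u'.2 := by
    intro u u' hu
    -- Two positions that agree on a spanning set of entries agree, by linearity, on every entry.
    have hall : ∀ s, v s u = v s u' := by
      intro s
      have hs : v s ∈ Submodule.span ℂ (Set.range (v ∘ a)) := by
        rw [hspan]; exact Submodule.subset_span ⟨s, rfl⟩
      generalize v s = w at hs
      induction hs using Submodule.span_induction with
      | mem w hw => obtain ⟨x, rfl⟩ := hw; exact hu x
      | zero => rfl
      | add w w' _ _ h1 h2 => simp [h1, h2]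
      | smul c w _ h1 => simp [h1]
    ext s
    have := hall s
    simp only [v] at this
    rw [mem_block, mem_block]
    by_cases h1 : g (u.1, s.1) = (u.2, s.2) <;> by_cases h2 : g (u'.1, s.1) = (u'.2, s.2) <;>
      simp_all
  let F : Finset (β × β) → Finset ι := fun k => Finset.univ.filter fun x => a x ∈ k
  have hF : Set.InjOn F (Finset.univ.image (blockColour g)) := by
    intro k hk k' hk' hkk
    obtain ⟨s, -, rfl⟩ := Finset.mem_image.1 (Finset.mem_coe.1 hk)
    obtain ⟨s', -, rfl⟩ := Finset.mem_image.1 (Finset.mem_coe.1 hk')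
    refine hinj (s.1, (g s).1) (s'.1, (g s').1) fun x => ?_
    have := congrArg (x ∈ ·) hkk
    simp only [F, Finset.mem_filter, Finset.mem_univ, true_and, blockColour, mem_block,
      eq_iff_iff] at this
    simp only [v, this]
  calc _ ≤ (Finset.univ : Finset (Finset ι)).card :=
        Finset.card_le_card_of_injOn F (fun _ _ => Finset.mem_coe.2 (Finset.mem_univ _)) hF
    _ = 2 ^ Fintype.card ι := by simp
    _ ≤ 2 ^ r := Nat.pow_le_pow_right (by norm_num) hcard

end Blocks

/-! ### Exchange of the parties and the bound by `costBound` -/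

lemma IsRectangular.comp_swap {α β κ : Type} [Finite α] [Finite β] {g : Equiv.Perm (α × β)}
    {c : β × α → κ} (h : IsRectangular ((Equiv.prodComm α β).permCongr g) c) :
    IsRectangular g (c ∘ Prod.swap) := by
  intro k
  obtain ⟨D, E, f, t, hf, ht, hc, hg⟩ := h k
  refine ⟨E, D, t, f, ht, hf, fun a b => (hc b a).trans and_comm, fun a ha b hb => ?_⟩
  have := hg b hb a ha
  simp only [Equiv.permCongr_apply, Equiv.prodComm_symm, Equiv.prodComm_apply,
    Prod.swap_prod_mk] at this
  exact Prod.swap_injective this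

lemma schmidt_swap {dA dB r : ℕ} {g : Equiv.Perm (Fin dA × Fin dB)}
    {A : Fin r → Matrix (Fin dA) (Fin dA) ℂ} {B : Fin r → Matrix (Fin dB) (Fin dB) ℂ}
    (h : ∀ s t, (if s = g t then 1 else 0 : ℂ) = ∑ l, A l s.1 t.1 * B l s.2 t.2) :
    ∀ s t, (if s = (Equiv.prodComm (Fin dA) (Fin dB)).permCongr g t then 1 else 0 : ℂ) =
      ∑ l, B l s.1 t.1 * A l s.2 t.2 := by
  intro s t
  have := h s.swap t.swap
  simp only [Prod.fst_swap, Prod.snd_swap] at this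
  simp only [mul_comm (B _ _ _), ← this, Equiv.permCongr_apply]
  exact if_congr (by rw [Equiv.prodComm_symm, Equiv.prodComm_apply, Equiv.prodComm_apply,
    ← Prod.swap_inj (p := s), Prod.swap_swap]) rfl rfl

/-- A permutation of Schmidt rank `r` has a rectangular colouring with `costBound` colours. -/
lemma exists_isRectangular {dA dB r : ℕ} {g : Equiv.Perm (Fin dA × Fin dB)}
    {A : Fin r → Matrix (Fin dA) (Fin dA) ℂ} {B : Fin r → Matrix (Fin dB) (Fin dB) ℂ}
    (h : ∀ s t, (if s = g t then 1 else 0 : ℂ) = ∑ l, A l s.1 t.1 * B l s.2 t.2) :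
    ∃ (κ : Type) (c : Fin dA × Fin dB → κ) (K : Finset κ),
      IsRectangular g c ∧ (∀ s, c s ∈ K) ∧ K.card ≤ costBound dA dB r := by
  have h' := schmidt_swap h
  have h1 := card_image_blockColour_le_sq g
  have h2 := card_image_blockColour_le_mul h
  have h3 := card_image_blockColour_le_two_pow h
  have h1' := card_image_blockColour_le_sq ((Equiv.prodComm (Fin dA) (Fin dB)).permCongr g)
  have h2' := card_image_blockColour_le_mul h'
  have h3' := card_image_blockColour_le_two_pow h'
  rw [Fintype.card_fin] at h1 h2 h1' h2'
  -- The colouring is taken on the side with the smaller bound; `2 ^ r` is available on both.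
  by_cases hle : min (dA ^ 2) (dA * r) ≤ min (dB ^ 2) (dB * r)
  · refine ⟨_, _, _, isRectangular_blockColour g,
      fun s => Finset.mem_image_of_mem _ (Finset.mem_univ s), ?_⟩
    simp only [costBound, le_min_iff]
    have := le_min h1 h2
    have := le_min_iff.1 (this.trans hle)
    exact ⟨h1, this.1, h2, this.2, h3⟩
  · refine ⟨_, _, Finset.univ.image (blockColour _),
      (isRectangular_blockColour _).comp_swap,
      fun s => Finset.mem_image_of_mem (blockColour _) (Finset.mem_univ s.swap), ?_⟩
    simp only [costBound, le_min_iff]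
    have := le_min h1' h2'
    have := le_min_iff.1 (this.trans (le_of_not_ge hle))
    exact ⟨this.1, h1', this.2, h2', h3'⟩

/-- A permutation of Schmidt rank `r` is a product of local permutations and `3 M` controlled
permutations, when the second party has one flag qubit. -/
lemma exists_layered_of_schmidtRank {dA dB r : ℕ} {g : Equiv.Perm (Fin dA × Fin dB)}
    {A : Fin r → Matrix (Fin dA) (Fin dA) ℂ} {B : Fin r → Matrix (Fin dB) (Fin dB) ℂ}
    (h : ∀ s t, (if s = g t then 1 else 0 : ℂ) = ∑ l, A l s.1 t.1 * B l s.2 t.2) :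
    ∃ n ≤ 3 * costBound dA dB r, ∃ p : Equiv.Perm (Party dA 0 × Party dB 1), Layered n p ∧
      ∀ a b, p ((a, 0), (b, 0)) = (((g (a, b)).1, 0), ((g (a, b)).2, 0)) := by
  obtain ⟨κ, c, K, hc, hK, hle⟩ := exists_isRectangular h
  obtain ⟨p, hp, hp'⟩ := hc.exists_layered K hK
  refine ⟨_, Nat.mul_le_mul_left 3 hle, _,
    hp.permCongr (Equiv.prodUnique (Fin dA) (Qubits 0)).symm
      ((Equiv.refl (Fin dB)).prodCongr (Equiv.funUnique (Fin 1) (Fin 2)).symm), fun a b => ?_⟩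
  have h0 : (Equiv.funUnique (Fin 1) (Fin 2)) 0 = 0 := rfl
  have h1 : (Equiv.funUnique (Fin 1) (Fin 2)).symm 0 = 0 := rfl
  simp only [Equiv.permCongr_apply, Equiv.prodCongr_symm, Equiv.symm_symm, Equiv.prodCongr_apply,
    Prod.map_apply, Equiv.prodUnique_apply, Equiv.refl_symm, Equiv.coe_refl, id, h0, hp', h1]
  exact Prod.ext (Prod.ext rfl (Subsingleton.elim _ _)) rfl

lemma costBound_comm (dA dB r : ℕ) : costBound dB dA r = costBound dA dB r := by
  simp only [costBound]
  omega

/-- A permutation of Schmidt rank `r` is a product of local permutations and `3 M` controlled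
permutations, when the first party has one flag qubit. -/
lemma exists_layered_of_schmidtRank' {dA dB r : ℕ} {g : Equiv.Perm (Fin dA × Fin dB)}
    {A : Fin r → Matrix (Fin dA) (Fin dA) ℂ} {B : Fin r → Matrix (Fin dB) (Fin dB) ℂ}
    (h : ∀ s t, (if s = g t then 1 else 0 : ℂ) = ∑ l, A l s.1 t.1 * B l s.2 t.2) :
    ∃ n ≤ 3 * costBound dA dB r, ∃ p : Equiv.Perm (Party dA 1 × Party dB 0), Layered n p ∧
      ∀ a b, p ((a, 0), (b, 0)) = (((g (a, b)).1, 0), ((g (a, b)).2, 0)) := by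
  obtain ⟨n, hn, p, hp, hp'⟩ := exists_layered_of_schmidtRank (schmidt_swap h)
  refine ⟨n, costBound_comm dA dB r ▸ hn, _, hp.permCongr_prodComm, fun a b => ?_⟩
  simp only [Equiv.permCongr_apply, Equiv.prodComm_symm, Equiv.prodComm_apply,
    Prod.swap_prod_mk, hp', Prod.fst_swap, Prod.snd_swap]

/-! ### Operators that permute basis states -/

section BasisMap

variable {ι : Type} [DecidableEq ι]

lemma basisMap_id : basisMap (id : ι → ι) = 1 := by
  ext s t
  simp [basisMap, Matrix.one_apply]

lemma basisMap_mul [Fintype ι] (f g : ι → ι) : basisMap f * basisMap g = basisMap (f ∘ g) := by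
  ext s t
  simp [basisMap, Matrix.mul_apply]

/-- Row `s` of `σ.permMatrix` has its `1` in column `σ s`, so the operator sends `|t⟩` to `|σ⁻¹ t⟩`.
This is the source of the inverses in the circuits. -/
lemma permMatrix_eq_basisMap (σ : Equiv.Perm ι) :
    σ.permMatrix ℂ = basisMap (σ⁻¹ : Equiv.Perm ι) := by
  ext s t
  simp only [basisMap, Equiv.Perm.permMatrix, PEquiv.toMatrix_apply, Equiv.toPEquiv_apply,
    Matrix.of_apply, Option.mem_some_iff]
  exact if_congr Equiv.Perm.eq_inv_iff_eq.symm rfl rfl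

end BasisMap

/-! ### Circuits of bipartite CNOT gates -/

section Circuits

variable {dA dB mA mB : ℕ}

/-- The action of a gate on basis states. -/
def Gate.onBasis : Gate dA dB mA mB →
    Party dA mA × Party dB mB → Party dA mA × Party dB mB
  | .localA σ => fun s => (σ⁻¹ s.1, s.2)
  | .localB σ => fun s => (s.1, σ⁻¹ s.2)
  | .cnotAB i j => fun s => (s.1, (s.2.1, Function.update s.2.2 j (s.2.2 j + s.1.2 i)))
  | .cnotBA j i => fun s => ((s.1.1, Function.update s.1.2 i (s.1.2 i + s.2.2 j)), s.2)

lemma Gate.toMatrix_eq (G : Gate dA dB mA mB) : G.toMatrix = basisMap G.onBasis := by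
  cases G with
  | localA σ =>
    ext s t
    simp [Gate.toMatrix, Gate.onBasis, permMatrix_eq_basisMap, basisMap, Matrix.kroneckerMap_apply,
      Matrix.one_apply, Prod.ext_iff, ← ite_and, and_comm]
  | localB σ =>
    ext s t
    simp [Gate.toMatrix, Gate.onBasis, permMatrix_eq_basisMap, basisMap, Matrix.kroneckerMap_apply,
      Matrix.one_apply, Prod.ext_iff, ← ite_and, and_comm]
  | cnotAB i j => rfl
  | cnotBA j i => rfl

lemma prod_map_toMatrix (c : List (Gate dA dB mA mB)) :
    (c.map Gate.toMatrix).prod = basisMap ((c.map Gate.onBasis).foldr (· ∘ ·) id) := by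
  induction c with
  | nil => simp [basisMap_id]
  | cons G c ih => simp [ih, Gate.toMatrix_eq, basisMap_mul]

/-- A register with one more qubit, which becomes the first one. -/
def consQubit (d m : ℕ) : Fin 2 × Party d m ≃ Party d (m + 1) where
  toFun s := (s.2.1, Fin.cons s.1 s.2.2)
  invFun s := (s.2 0, (s.1, Fin.tail s.2))
  left_inv s := by simp
  right_inv s := by simp

lemma onBasis_cnotAB (w v : Fin 2) (x : Party dA mA) (y : Party dB mB) :
    (Gate.cnotAB 0 0).onBasis (consQubit dA mA (w, x), consQubit dB mB (v, y)) =
      (consQubit dA mA (w, x), consQubit dB mB (v + w, y)) := by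
  simp [Gate.onBasis, consQubit]

lemma onBasis_cnotBA (w v : Fin 2) (x : Party dA mA) (y : Party dB mB) :
    (Gate.cnotBA 0 0).onBasis (consQubit dA mA (w, x), consQubit dB mB (v, y)) =
      (consQubit dA mA (w + v, x), consQubit dB mB (v, y)) := by
  simp [Gate.onBasis, consQubit]

/-- Flip the first qubit if the rest of the register satisfies `q`. -/
def flipQubit {d m : ℕ} (q : Party d m → Bool) : Equiv.Perm (Party d (m + 1)) :=
  (consQubit d m).permCongr (condLeft q (Equiv.swap 0 1))

/-- Apply `θ` to the rest of the register if the first qubit is `1`. -/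
def onRest {d m : ℕ} (q : Fin 2 → Bool) (θ : Equiv.Perm (Party d m)) :
    Equiv.Perm (Party d (m + 1)) :=
  (consQubit d m).permCongr (condRight q θ)

lemma inv_flipQubit_apply {d m : ℕ} (q : Party d m → Bool) (w : Fin 2) (x : Party d m) :
    (flipQubit q)⁻¹ (consQubit d m (w, x)) =
      consQubit d m (w + if q x then 1 else 0, x) := by
  rw [Equiv.Perm.inv_eq_iff_eq]
  cases h : q x <;> fin_cases w <;>
    simp [flipQubit, Equiv.permCongr_apply, condLeft_apply, h]

lemma inv_onRest_inv_apply {d m : ℕ} (q : Fin 2 → Bool) (θ : Equiv.Perm (Party d m)) (w : Fin 2)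
    (x : Party d m) :
    (onRest q θ⁻¹)⁻¹ (consQubit d m (w, x)) =
      consQubit d m (w, if q w then θ x else x) := by
  rw [Equiv.Perm.inv_eq_iff_eq]
  cases h : q w <;> simp [onRest, Equiv.permCongr_apply, condRight_apply, h]

lemma Layered.exists_circuit {n : ℕ} {p : Equiv.Perm (Party dA mA × Party dB mB)}
    (hp : Layered n p) : ∃ c : List (Gate dA dB (mA + 1) (mB + 1)),
      (c.map Gate.cnotCost).sum = 2 * n ∧
      ∀ x y, (c.map Gate.onBasis).foldr (· ∘ ·) id
          (consQubit dA mA (0, x), consQubit dB mB (0, y)) =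
        (consQubit dA mA (0, (p (x, y)).1), consQubit dB mB (0, (p (x, y)).2)) := by
  have key : ∀ (c c' : List (Gate dA dB (mA + 1) (mB + 1))) s,
      ((c ++ c').map Gate.onBasis).foldr (· ∘ ·) id s = (c.map Gate.onBasis).foldr (· ∘ ·) id
        ((c'.map Gate.onBasis).foldr (· ∘ ·) id s) := by
    intro c c' s
    induction c with
    | nil => rfl
    | cons G c ih => simpa using congrArg G.onBasis ih
  have hw : ∀ w : Fin 2, w + w = 0 := by decide
  have hA : ∀ (σ : Equiv.Perm (Party dA (mA + 1))) s,
    (Gate.localA (dB := dB) (mB := mB + 1) σ).onBasis s = (σ⁻¹ s.1, s.2) := fun _ _ => rfl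
  have hB : ∀ (σ : Equiv.Perm (Party dB (mB + 1))) s,
    (Gate.localB (dA := dA) (mA := mA + 1) σ).onBasis s = (s.1, σ⁻¹ s.2) := fun _ _ => rfl
  induction hp with
  | one => exact ⟨[], rfl, fun x y => rfl⟩
  | mulLeft _ θ ih =>
    obtain ⟨c, hc, h⟩ := ih
    refine ⟨c ++ [.localA (onRest (fun _ => true) θ⁻¹)], by simp [hc, Gate.cnotCost], fun x y => ?_⟩
    rw [key]
    simp only [List.map_cons, List.map_nil, List.foldr_cons, List.foldr_nil, Function.comp_apply,
      id, Equiv.Perm.mul_apply, condLeft_apply, hA, inv_onRest_inv_apply, h, if_true]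
  | mulRight _ θ ih =>
    obtain ⟨c, hc, h⟩ := ih
    refine ⟨c ++ [.localB (onRest (fun _ => true) θ⁻¹)], by simp [hc, Gate.cnotCost], fun x y => ?_⟩
    rw [key]
    simp only [List.map_cons, List.map_nil, List.foldr_cons, List.foldr_nil, Function.comp_apply,
      id, Equiv.Perm.mul_apply, condRight_apply, hB, inv_onRest_inv_apply, h, if_true]
  | mulCondLeft _ q θ ih =>
    obtain ⟨c, hc, h⟩ := ih
    -- The second party writes `q y` into its spare qubit, a CNOT copies it across, `θ` is
    -- controlled locally, and the same two gates erase both copies. Appended gates act first, as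
    -- does the right factor of a product.
    refine ⟨c ++ [.localB (flipQubit q), .cnotBA 0 0, .localA (onRest (fun w => w = 1) θ⁻¹),
      .cnotBA 0 0, .localB (flipQubit q)], by simp [hc, Gate.cnotCost, mul_add], fun x y => ?_⟩
    rw [key]
    simp only [List.map_cons, List.map_nil, List.foldr_cons, List.foldr_nil, Function.comp_apply,
      id, onBasis_cnotBA, Equiv.Perm.mul_apply, condLeft_apply, hA, hB, inv_flipQubit_apply,
      inv_onRest_inv_apply, zero_add, hw, h]
    cases hq : q y <;> simp
  | mulCondRight _ q θ ih =>
    obtain ⟨c, hc, h⟩ := ih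
    refine ⟨c ++ [.localA (flipQubit q), .cnotAB 0 0, .localB (onRest (fun w => w = 1) θ⁻¹),
      .cnotAB 0 0, .localA (flipQubit q)], by simp [hc, Gate.cnotCost, mul_add], fun x y => ?_⟩
    rw [key]
    simp only [List.map_cons, List.map_nil, List.foldr_cons, List.foldr_nil, Function.comp_apply,
      id, onBasis_cnotAB, Equiv.Perm.mul_apply, condRight_apply, hA, hB, inv_flipQubit_apply,
      inv_onRest_inv_apply, zero_add, hw, h]
    cases hq : q x <;> simp

/-- A layered permutation that restores the ancilla qubits is implemented by two CNOT gates per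
layer, with one more ancilla qubit at each party. -/
lemma Layered.implementedByCNOTs {n N : ℕ} {p : Equiv.Perm (Party dA mA × Party dB mB)}
    (hp : Layered n p) {g : Equiv.Perm (Fin dA × Fin dB)}
    (hg : ∀ a b, p ((a, 0), (b, 0)) = (((g (a, b)).1, 0), ((g (a, b)).2, 0)))
    (hN : 2 * n ≤ N) : ImplementedByCNOTs (basisMap g) (mA + 1) (mB + 1) N := by
  obtain ⟨c, hc, h⟩ := hp.exists_circuit
  refine ⟨c, hc.trans_le hN, fun ψ => ?_⟩
  rw [prod_map_toMatrix]
  generalize (c.map Gate.onBasis).foldr (· ∘ ·) id = F at h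
  have hz : ∀ d m (a : Fin d), consQubit d m (0, (a, 0)) = (a, 0) := by
    intro d m a
    simp only [consQubit, Equiv.coe_fn_mk]
    congr 1
    ext i
    cases i using Fin.cases <;> rfl
  have hF : ∀ a b, F ((a, 0), (b, 0)) = (((g (a, b)).1, 0), ((g (a, b)).2, 0)) := by
    intro a b
    have := h (a, 0) (b, 0)
    rwa [hg, hz, hz, hz, hz] at this
  -- By linearity only basis states with ancillas in zero need to be followed.
  have hsum : ∀ φ : Fin dA × Fin dB → ℂ, withAncillas (mA + 1) (mB + 1) φ =
      ∑ t : Fin dA × Fin dB, φ t • Pi.single ((t.1, 0), (t.2, 0)) 1 := by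
    intro φ
    ext ⟨⟨a, e⟩, ⟨b, f⟩⟩
    by_cases he : e = 0 <;> by_cases hf : f = 0 <;>
      simp [withAncillas, he, hf, Fintype.sum_prod_type, Pi.single_apply, ite_and]
  have hψ : ∀ t, (basisMap g *ᵥ ψ) (g t) = ψ t := by
    intro t
    simp [Matrix.mulVec, dotProduct, basisMap]
  rw [hsum, hsum (basisMap g *ᵥ ψ), Matrix.mulVec_sum]
  refine Eq.trans ?_ (Equiv.sum_comp g _)
  refine Finset.sum_congr rfl fun t _ => ?_
  rw [hψ, Matrix.mulVec_smul, Matrix.mulVec_single_one]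
  congr 1
  ext s
  simp [Matrix.col_apply, basisMap, hF t.1 t.2, Pi.single_apply]

end Circuits

/-! ### LOCC protocols that consume ebits -/

section Protocols

variable {α β X Y : Type} [Fintype α] [DecidableEq α] [Fintype β] [DecidableEq β]
  [Fintype X] [DecidableEq X] [Fintype Y] [DecidableEq Y] {k : ℕ}

/-- Collapses successive operations of a protocol branch into a single Kraus operator. -/
lemma conj_conj {ι κ μ : Type} [Fintype ι] [Fintype κ] [Fintype μ] (V : Matrix ι κ ℂ)
    (K : Matrix κ μ ℂ) (ρ : Matrix μ μ ℂ) : V * (K * ρ * Kᴴ) * Vᴴ = V * K * ρ * (V * K)ᴴ := by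
  simp only [Matrix.conjTranspose_mul, Matrix.mul_assoc]

/-- The protocol with the roles of the parties exchanged. -/
def LOCC.swap : LOCC α β → LOCC β α
  | .done => .done
  | .unitaryA V next => .unitaryB V next.swap
  | .unitaryB V next => .unitaryA V next.swap
  | .measureA n P hP next => .measureB n P hP fun i => (next i).swap
  | .measureB n P hP next => .measureA n P hP fun i => (next i).swap

omit [DecidableEq α] [DecidableEq β] in
lemma submatrix_swap_conj (V : Matrix (α × β) (α × β) ℂ) (W : Matrix (β × α) (β × α) ℂ)
    (h : W = V.submatrix Prod.swap Prod.swap) (ρ : Matrix (α × β) (α × β) ℂ) :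
    W * ρ.submatrix Prod.swap Prod.swap * Wᴴ = (V * ρ * Vᴴ).submatrix Prod.swap Prod.swap := by
  subst h
  let e := Equiv.prodComm β α
  change V.submatrix e e * ρ.submatrix e e * (V.submatrix e e)ᴴ = (V * ρ * Vᴴ).submatrix e e
  rw [Matrix.conjTranspose_submatrix, Matrix.submatrix_mul_equiv, Matrix.submatrix_mul_equiv]

omit [Fintype α] [DecidableEq α] [Fintype β] in
lemma one_kronecker_submatrix_swap (V : Matrix α α ℂ) :
    (1 : Matrix β β ℂ) ⊗ₖ V = (V ⊗ₖ (1 : Matrix β β ℂ)).submatrix Prod.swap Prod.swap := by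
  ext ⟨b, a⟩ ⟨b', a'⟩
  simp [Matrix.kroneckerMap_apply, mul_comm]

omit [Fintype α] [Fintype β] [DecidableEq β] in
lemma kronecker_one_submatrix_swap (V : Matrix β β ℂ) :
    V ⊗ₖ (1 : Matrix α α ℂ) = ((1 : Matrix α α ℂ) ⊗ₖ V).submatrix Prod.swap Prod.swap := by
  ext ⟨b, a⟩ ⟨b', a'⟩
  simp [Matrix.kroneckerMap_apply, mul_comm]

lemma LOCC.run_swap (p : LOCC α β) (ρ : Matrix (α × β) (α × β) ℂ) :
    p.swap.run (ρ.submatrix Prod.swap Prod.swap) = (p.run ρ).submatrix Prod.swap Prod.swap := by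
  have hsum : ∀ {n : ℕ} (f : Fin n → Matrix (α × β) (α × β) ℂ),
      (∑ i, f i).submatrix (Prod.swap (α := β)) Prod.swap =
        ∑ i, (f i).submatrix Prod.swap Prod.swap := by
    intro n f
    ext s t
    simp [Matrix.sum_apply]
  induction p generalizing ρ with
  | done => rfl
  | unitaryA V next ih =>
    simp only [LOCC.swap, LOCC.run, ← ih,
      submatrix_swap_conj _ _ (one_kronecker_submatrix_swap V.1)]
  | unitaryB V next ih =>
    simp only [LOCC.swap, LOCC.run, ← ih,
      submatrix_swap_conj _ _ (kronecker_one_submatrix_swap V.1)]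
  | measureA n P hP next ih =>
    simp only [LOCC.swap, LOCC.run, hsum, ← ih,
      submatrix_swap_conj _ _ (one_kronecker_submatrix_swap (P _))]
  | measureB n P hP next ih =>
    simp only [LOCC.swap, LOCC.run, hsum, ← ih,
      submatrix_swap_conj _ _ (kronecker_one_submatrix_swap (P _))]

/-- Adjoin two registers of `k` qubits in the joint state `φ`. -/
def adjoin (X Y : Type) [DecidableEq X] [DecidableEq Y] (φ : Qubits k → Qubits k → ℂ) :
    Matrix ((X × Qubits k) × (Y × Qubits k)) (X × Y) ℂ :=
  Matrix.of fun s t => if (s.1.1, s.2.1) = t then φ s.1.2 s.2.2 else 0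

/-- When the parties share the state `φ` of two registers of `k` qubits, some protocol
implements `p`. -/
def Realizes (φ : Qubits k → Qubits k → ℂ) (p : Equiv.Perm (X × Y)) : Prop :=
  ∃ P : LOCC (X × Qubits k) (Y × Qubits k), ∀ ρ : Matrix (X × Y) (X × Y) ℂ,
    traceEbits (P.run (adjoin X Y φ * ρ * (adjoin X Y φ)ᴴ)) =
      (∑ e, ∑ f, φ e f * star (φ e f)) • (basisMap p * ρ * (basisMap p)ᴴ)

omit [Fintype X] [DecidableEq X] [Fintype Y] [DecidableEq Y] in
lemma traceEbits_sum {n : ℕ}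
    (f : Fin n → Matrix ((X × Qubits k) × (Y × Qubits k)) ((X × Qubits k) × (Y × Qubits k)) ℂ) :
    traceEbits (∑ i, f i) = ∑ i, traceEbits (f i) := by
  ext s t
  simp only [traceEbits, Matrix.sum_apply, Matrix.of_apply]
  conv_rhs => rw [Finset.sum_comm]
  refine Finset.sum_congr rfl fun e _ => ?_
  exact Finset.sum_comm

lemma adjoin_conj_apply (φ : Qubits k → Qubits k → ℂ) (ρ : Matrix (X × Y) (X × Y) ℂ) (s t) :
    (adjoin X Y φ * ρ * (adjoin X Y φ)ᴴ) s t =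
      φ s.1.2 s.2.2 * ρ (s.1.1, s.2.1) (t.1.1, t.2.1) * star (φ t.1.2 t.2.2) := by
  simp [Matrix.mul_apply, adjoin, apply_ite]

/-- Tracing out the registers leaves the squared norm of `φ`. Keeping this weight lets unnormalised
post-measurement states be treated like any others. -/
lemma realizes_one (φ : Qubits k → Qubits k → ℂ) : Realizes φ (1 : Equiv.Perm (X × Y)) := by
  refine ⟨.done, fun ρ => ?_⟩
  have : basisMap ((1 : Equiv.Perm (X × Y)) : X × Y → X × Y) = 1 := basisMap_id
  ext s t
  simp only [LOCC.run, traceEbits, adjoin_conj_apply, Matrix.of_apply, this, Matrix.one_mul,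
    Matrix.conjTranspose_one, Matrix.mul_one, Matrix.smul_apply, smul_eq_mul, Finset.sum_mul]
  exact Finset.sum_congr rfl fun e _ => Finset.sum_congr rfl fun f _ => by ring

omit [Fintype X] [Fintype Y] in
lemma basisMap_permCongr_prodComm (p : Equiv.Perm (X × Y)) :
    basisMap ((Equiv.prodComm X Y).permCongr p) =
      (basisMap p).submatrix Prod.swap Prod.swap := by
  ext s t
  simp only [basisMap, Matrix.of_apply, Matrix.submatrix_apply, Equiv.permCongr_apply]
  exact if_congr (by rw [Equiv.prodComm_symm, Equiv.prodComm_apply, Equiv.prodComm_apply,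
    ← Prod.swap_inj (p := s), Prod.swap_swap]) rfl rfl

lemma Realizes.swap {φ : Qubits k → Qubits k → ℂ} {p : Equiv.Perm (X × Y)}
    (h : Realizes φ p) : Realizes (fun e f => φ f e) ((Equiv.prodComm X Y).permCongr p) := by
  obtain ⟨P, hP⟩ := h
  refine ⟨P.swap, fun ρ => ?_⟩
  have h1 : adjoin Y X (fun e f => φ f e) * ρ * (adjoin Y X (fun e f => φ f e))ᴴ =
      (adjoin X Y φ * ρ.submatrix Prod.swap Prod.swap * (adjoin X Y φ)ᴴ).submatrix
        Prod.swap Prod.swap := by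
    ext s t
    simp [adjoin_conj_apply]
  have h2 : ρ = (ρ.submatrix Prod.swap Prod.swap).submatrix Prod.swap Prod.swap := by
    ext s t; simp
  rw [h1, LOCC.run_swap, Finset.sum_comm]
  nth_rewrite 2 [h2]
  rw [submatrix_swap_conj _ _ (basisMap_permCongr_prodComm p)]
  have h3 := hP (ρ.submatrix Prod.swap Prod.swap)
  ext s t
  have h4 := congrFun (congrFun h3 s.swap) t.swap
  simp only [Matrix.smul_apply, Matrix.submatrix_apply, traceEbits, Matrix.of_apply] at h4 ⊢
  rw [← h4, Finset.sum_comm]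
  rfl

end Protocols

/-! ### Controlled permutations at the cost of one ebit each -/

section Layers

variable {α β X Y : Type} [Fintype α] [DecidableEq α] [Fintype β] [DecidableEq β]
  [Fintype X] [DecidableEq X] [Fintype Y] [DecidableEq Y] {k : ℕ}

/-- The qubits `i` of the two registers are in the state `|00⟩ + |11⟩`, up to a scalar, and not
entangled with the other qubits. -/
def IsFresh (i : Fin k) (φ : Qubits k → Qubits k → ℂ) : Prop :=
  ∀ e f, φ e f = if e i = f i then φ (Function.update e i 0) (Function.update f i 0) else 0

/-! #### Local operations -/

omit [Fintype α] in
lemma basisMap_conjTranspose (σ : Equiv.Perm α) :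
    (basisMap σ)ᴴ = basisMap (σ⁻¹ : Equiv.Perm α) := by
  ext s t
  simp only [basisMap, Matrix.conjTranspose_apply, Matrix.of_apply, apply_ite star, star_one,
    star_zero]
  exact if_congr (by rw [Equiv.Perm.eq_inv_iff_eq, eq_comm]) rfl rfl

lemma basisMap_mem_unitaryGroup (σ : Equiv.Perm α) :
    basisMap σ ∈ Matrix.unitaryGroup α ℂ := by
  rw [Matrix.mem_unitaryGroup_iff, Matrix.star_eq_conjTranspose, basisMap_conjTranspose,
    basisMap_mul, ← Equiv.Perm.coe_mul, mul_inv_cancel]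
  exact basisMap_id

lemma basisMap_kronecker_one_mul_apply {τ : Type} (σ : Equiv.Perm α)
    (K : Matrix (α × β) τ ℂ) (a b t) :
    (((basisMap σ) ⊗ₖ (1 : Matrix β β ℂ)) * K) (a, b) t = K (σ⁻¹ a, b) t := by
  simp only [Matrix.mul_apply, Matrix.kroneckerMap_apply, basisMap, Matrix.of_apply,
    Matrix.one_apply, ← Equiv.Perm.inv_eq_iff_eq, Fintype.sum_prod_type]
  simp

lemma one_kronecker_basisMap_mul_apply {τ : Type} (σ : Equiv.Perm β)
    (K : Matrix (α × β) τ ℂ) (a b t) :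
    (((1 : Matrix α α ℂ) ⊗ₖ (basisMap σ)) * K) (a, b) t = K (a, σ⁻¹ b) t := by
  simp only [Matrix.mul_apply, Matrix.kroneckerMap_apply, basisMap, Matrix.of_apply,
    Matrix.one_apply, ← Equiv.Perm.inv_eq_iff_eq, Fintype.sum_prod_type]
  simp

lemma diagonal_kronecker_one_mul_apply {τ : Type} (d : α → ℂ) (K : Matrix (α × β) τ ℂ) (a b t) :
    ((Matrix.diagonal d ⊗ₖ (1 : Matrix β β ℂ)) * K) (a, b) t = d a * K (a, b) t := by
  simp [Matrix.mul_apply, Matrix.kroneckerMap_apply, Matrix.diagonal_apply,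
    Matrix.one_apply, Fintype.sum_prod_type]

/-- Flip the qubit `i` if the system satisfies `q`. -/
def flipAt (q : X → Bool) (i : Fin k) : Equiv.Perm (X × Qubits k) :=
  Function.Involutive.toPerm
    (fun s => (s.1, if q s.1 then Function.update s.2 i (s.2 i + 1) else s.2))
    (by
      have h : ∀ w : Fin 2, w + 1 + 1 = w := by decide
      rintro ⟨x, e⟩
      cases hq : q x <;> simp [hq, h])

omit [Fintype X] [DecidableEq X] in
lemma flipAt_apply (q : X → Bool) (i : Fin k) (x : X) (e : Qubits k) :
    flipAt q i (x, e) = (x, if q x then Function.update e i (e i + 1) else e) := rfl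

omit [Fintype X] [DecidableEq X] in
lemma flipAt_inv (q : X → Bool) (i : Fin k) : (flipAt q i)⁻¹ = flipAt q i := rfl

/-- The measurement of the qubit `i` in the computational basis. -/
def computationalProj (X : Type) [DecidableEq X] (i : Fin k) (m : Fin 2) :
    Matrix (X × Qubits k) (X × Qubits k) ℂ :=
  Matrix.diagonal fun s => if s.2 i = m then 1 else 0

lemma isProjectiveMeasurement_computationalProj (i : Fin k) :
    IsProjectiveMeasurement (computationalProj X i) where
  hermitian m := by
    rw [computationalProj, Matrix.isHermitian_diagonal_iff]
    intro s
    by_cases h : s.2 i = m <;> simp [h]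
  idempotent m := by simp [computationalProj, Matrix.diagonal_mul_diagonal]
  orthogonal m m' h := by
    rw [computationalProj, computationalProj, Matrix.diagonal_mul_diagonal, Matrix.diagonal_eq_zero]
    ext s
    by_cases h1 : s.2 i = m
    · have h2 : s.2 i ≠ m' := fun h2 => h (h1.symm.trans h2)
      simp [h2]
    · simp [h1]
  complete := by
    rw [Fin.sum_univ_two, computationalProj, computationalProj, Matrix.diagonal_add,
      ← Matrix.diagonal_one]
    congr 1
    ext s
    generalize s.2 i = w
    fin_cases w <;> simp

/-- The measurement of the qubit `i` in the basis `|0⟩ ± |1⟩`. -/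
noncomputable def conjugateProj (X : Type) [DecidableEq X] (i : Fin k) (s : Fin 2) :
    Matrix (X × Qubits k) (X × Qubits k) ℂ :=
  (1 / 2 : ℂ) • (1 + (if s = 1 then -1 else 1 : ℂ) • basisMap (flipAt (fun _ : X => true) i))

/-- The flip is a self-adjoint involution `F`, so `(1 ± F) / 2` are the projections onto its two
eigenspaces. -/
lemma isProjectiveMeasurement_conjugateProj (i : Fin k) :
    IsProjectiveMeasurement (conjugateProj X i) := by
  have hH : (basisMap (flipAt (fun _ : X => true) i))ᴴ =
      basisMap (flipAt (fun _ : X => true) i) := by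
    rw [basisMap_conjTranspose, flipAt_inv]
  have hm : basisMap (flipAt (fun _ : X => true) i) *
      basisMap (flipAt (fun _ : X => true) i) = 1 := by
    nth_rewrite 2 [← hH]
    exact (Matrix.mem_unitaryGroup_iff.1 (basisMap_mem_unitaryGroup _))
  have hmul : ∀ s s', conjugateProj X i s * conjugateProj X i s' =
      (1 / 4 : ℂ) • ((1 + (if s = 1 then -1 else 1) * (if s' = 1 then -1 else 1) : ℂ) • 1 +
        ((if s = 1 then -1 else 1) + (if s' = 1 then -1 else 1) : ℂ) •
          basisMap (flipAt (fun _ : X => true) i)) := by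
    intro s s'
    simp only [conjugateProj, Matrix.smul_mul, Matrix.mul_smul, add_mul, mul_add, one_mul, mul_one,
      hm]
    module
  refine ⟨fun s => ?_, fun s => ?_, fun s s' h => ?_, ?_⟩
  · have h2 : star (if s = 1 then -1 else 1 : ℂ) = if s = 1 then -1 else 1 := by
      split_ifs <;> simp
    rw [Matrix.IsHermitian, conjugateProj, Matrix.conjTranspose_smul, Matrix.conjTranspose_add,
      Matrix.conjTranspose_smul, hH, h2, Matrix.conjTranspose_one]
    simp
  · rw [hmul]
    simp only [conjugateProj]
    split_ifs <;> module
  · rw [hmul]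
    fin_cases s <;> fin_cases s' <;> simp at h ⊢
  · rw [Fin.sum_univ_two]
    simp only [conjugateProj, if_true, zero_ne_one, if_false]
    module

/-- The phase `-1` on the system states that satisfy `q`. -/
def phase (k : ℕ) (q : X → Bool) (s : Fin 2) : Matrix (X × Qubits k) (X × Qubits k) ℂ :=
  Matrix.diagonal fun u => if s = 1 ∧ q u.1 then -1 else 1

lemma phase_mem_unitaryGroup (q : X → Bool) (s : Fin 2) :
    phase k q s ∈ Matrix.unitaryGroup (X × Qubits k) ℂ := by
  rw [Matrix.mem_unitaryGroup_iff, Matrix.star_eq_conjTranspose, phase,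
    Matrix.diagonal_conjTranspose, Matrix.diagonal_mul_diagonal, ← Matrix.diagonal_one]
  congr 1
  ext u
  by_cases h : s = 1 ∧ q u.1 <;> simp [h]

/-! #### A controlled permutation consumes an ebit -/

/-- The state of the registers after the outcomes `m` and `s` of the two measurements. -/
noncomputable def measured (i : Fin k) (m s : Fin 2) (φ : Qubits k → Qubits k → ℂ) :
    Qubits k → Qubits k → ℂ :=
  fun e f => if e i = m then (1 / 2) * (if s = 1 ∧ f i ≠ m then -1 else 1) *
    φ (Function.update e i 0) (Function.update f i 0) else 0

lemma isFresh_measured {i j : Fin k} (hij : j ≠ i) (m s : Fin 2) {φ : Qubits k → Qubits k → ℂ}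
    (h : IsFresh j φ) : IsFresh j (measured i m s φ) := by
  intro e f
  simp only [measured, Function.update_of_ne hij.symm]
  rw [h, Function.update_of_ne hij, Function.update_of_ne hij, Function.update_comm hij _ _ e,
    Function.update_comm hij _ _ f]
  split_ifs <;> simp

/-- Conservation of probability over the four outcomes. Each `e` is compatible with one `m` and both
`s`, giving half of the sum of `N`; as `N f` does not depend on `f i`, that is the sum over the `f`
with `f i = e i`. -/
lemma IsFresh.sum_measured {i : Fin k} {φ : Qubits k → Qubits k → ℂ} (h : IsFresh i φ) :
    ∑ m, ∑ s, ∑ e, ∑ f, measured i m s φ e f * star (measured i m s φ e f) =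
      ∑ e, ∑ f, φ e f * star (φ e f) := by
  simp only [Fin.sum_univ_two, ← Finset.sum_add_distrib]
  refine Finset.sum_congr rfl fun e _ => ?_
  let N : Qubits k → ℂ := fun f => φ (Function.update e i 0) (Function.update f i 0) *
    star (φ (Function.update e i 0) (Function.update f i 0))
  have h1 : ∀ f, measured i 0 0 φ e f * star (measured i 0 0 φ e f) +
      measured i 0 1 φ e f * star (measured i 0 1 φ e f) +
      (measured i 1 0 φ e f * star (measured i 1 0 φ e f) +
      measured i 1 1 φ e f * star (measured i 1 1 φ e f)) = (1 / 2) * N f := by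
    intro f
    simp only [measured, N]
    generalize e i = u
    generalize f i = v
    fin_cases u <;> fin_cases v <;> simp <;> ring
  have h2 : ∀ f, φ e f * star (φ e f) = if e i = f i then N f else 0 := by
    intro f
    rw [h e f]
    split_ifs <;> simp [N]
  have hw : ∀ w : Fin 2, w + 1 + 1 = w := by decide
  let σ : Equiv.Perm (Qubits k) :=
    Function.Involutive.toPerm (fun f => Function.update f i (f i + 1)) fun f => by simp [hw]
  have h3 : ∑ f, (if e i = f i then N f else 0) = ∑ f, if e i = f i then 0 else N f := by
    rw [← Equiv.sum_comp σ]
    refine Finset.sum_congr rfl fun f _ => ?_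
    have hσ : σ f = Function.update f i (f i + 1) := rfl
    simp only [N, hσ, Function.update_self, Function.update_idem]
    generalize e i = u
    generalize f i = v
    fin_cases u <;> fin_cases v <;> simp
  have h4 : ∑ f, N f = (∑ f, if e i = f i then N f else 0) + ∑ f, if e i = f i then 0 else N f := by
    rw [← Finset.sum_add_distrib]
    exact Finset.sum_congr rfl fun f _ => by split_ifs <;> simp
  simp only [h1, h2, ← Finset.mul_sum]
  rw [h4, ← h3]
  ring

lemma mul_basisMap_apply {τ : Type} (f : X → X) (K : Matrix τ X ℂ) (u : τ) (t : X) :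
    (K * basisMap f) u t = K u (f t) := by
  simp [Matrix.mul_apply, basisMap]

omit [Fintype X] [DecidableEq X] [Fintype Y] [DecidableEq Y] in
lemma condLeft_inv_apply (q : Y → Bool) (θ : Equiv.Perm X) (s : X × Y) :
    (condLeft q θ)⁻¹ s = (if q s.2 then θ⁻¹ s.1 else s.1, s.2) := by
  rw [Equiv.Perm.inv_eq_iff_eq, condLeft_apply]
  cases q s.2 <;> simp

lemma one_kronecker_conjugateProj_mul_apply {τ : Type} (i : Fin k) (s : Fin 2)
    (K : Matrix (α × (Y × Qubits k)) τ ℂ) (a y f t) :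
    (((1 : Matrix α α ℂ) ⊗ₖ conjugateProj Y i s) * K) (a, (y, f)) t =
      1 / 2 * (K (a, (y, f)) t + (if s = 1 then -1 else 1) *
        K (a, (y, Function.update f i (f i + 1))) t) := by
  rw [conjugateProj, Matrix.kronecker_smul, Matrix.kronecker_add, Matrix.kronecker_smul,
    Matrix.one_kronecker_one, Matrix.smul_mul, Matrix.add_mul, Matrix.smul_mul, Matrix.one_mul]
  simp only [Matrix.smul_apply, Matrix.add_apply, one_kronecker_basisMap_mul_apply, flipAt_inv,
    flipAt_apply, if_true, smul_eq_mul]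

/-- After the first party's flip by `q x` and outcome `m`, the partner qubit is `m + q x`, so it
differs from `m` exactly when `θ` is due. The second measurement erases this copy at the price of a
sign depending on `q x` when `s = 1`, which the phase removes. The remaining register state does not
depend on the system. -/
lemma measured_protocol (q : X → Bool) (θ : Equiv.Perm Y) {i : Fin k}
    {φ : Qubits k → Qubits k → ℂ} (h : IsFresh i φ) (m s : Fin 2) :
    (phase k q s ⊗ₖ (1 : Matrix (Y × Qubits k) (Y × Qubits k) ℂ)) *
      (((1 : Matrix (X × Qubits k) (X × Qubits k) ℂ) ⊗ₖ conjugateProj Y i s) *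
      (((1 : Matrix (X × Qubits k) (X × Qubits k) ℂ) ⊗ₖ
        basisMap (condLeft (fun f : Qubits k => decide (f i ≠ m)) θ)) *
      ((computationalProj X i m ⊗ₖ (1 : Matrix (Y × Qubits k) (Y × Qubits k) ℂ)) *
      ((basisMap (flipAt q i) ⊗ₖ (1 : Matrix (Y × Qubits k) (Y × Qubits k) ℂ)) *
        adjoin X Y φ)))) = adjoin X Y (measured i m s φ) * basisMap (condRight q θ) := by
  ext ⟨⟨x, e⟩, ⟨y, f⟩⟩ ⟨x', y'⟩
  rw [mul_basisMap_apply, phase, diagonal_kronecker_one_mul_apply,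
    one_kronecker_conjugateProj_mul_apply, computationalProj]
  simp only [one_kronecker_basisMap_mul_apply, diagonal_kronecker_one_mul_apply,
    basisMap_kronecker_one_mul_apply, condLeft_inv_apply, flipAt_inv, flipAt_apply,
    condRight_apply, adjoin, Matrix.of_apply, measured, Prod.mk.injEq]
  by_cases hx : x = x'
  swap
  · simp [hx]
  subst hx
  have h1 : φ e f = if e i = f i then
      φ (Function.update e i 0) (Function.update f i 0) else 0 := h e f
  have h2 : φ e (Function.update f i (f i + 1)) = if e i = f i + 1 then
      φ (Function.update e i 0) (Function.update f i 0) else 0 := by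
    rw [h]
    simp
  have h3 : φ (Function.update e i (e i + 1)) f = if e i + 1 = f i then
      φ (Function.update e i 0) (Function.update f i 0) else 0 := by
    rw [h]
    simp
  have h4 : φ (Function.update e i (e i + 1)) (Function.update f i (f i + 1)) =
      if e i + 1 = f i + 1 then φ (Function.update e i 0) (Function.update f i 0) else 0 := by
    rw [h]
    simp
  have hy : θ⁻¹ y = y' ↔ y = θ y' := Equiv.Perm.inv_eq_iff_eq
  cases hq : q x <;> simp only [Function.update_self, h1, h2, h3, h4, true_and,
    if_true, if_false, Bool.false_eq_true, and_true, and_false]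
  all_goals
    generalize φ (Function.update e i 0) (Function.update f i 0) = z
    have hfin : ∀ w : Fin 2, w = 0 ∨ w = 1 := by decide
    obtain hu | hu := hfin (e i) <;> obtain hv | hv := hfin (f i) <;>
      obtain rfl | rfl := hfin m <;> obtain rfl | rfl := hfin s <;> simp [hu, hv, ← hy]

lemma traceEbits_run_measure (V : Matrix.unitaryGroup (X × Qubits k) ℂ) {n n' : ℕ}
    {Q : Fin n → Matrix (X × Qubits k) (X × Qubits k) ℂ} (hQ : IsProjectiveMeasurement Q)
    (W : Fin n → Matrix.unitaryGroup (Y × Qubits k) ℂ)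
    {R : Fin n' → Matrix (Y × Qubits k) (Y × Qubits k) ℂ} (hR : IsProjectiveMeasurement R)
    (Z : Fin n' → Matrix.unitaryGroup (X × Qubits k) ℂ)
    (P : Fin n → Fin n' → LOCC (X × Qubits k) (Y × Qubits k))
    (K : Matrix ((X × Qubits k) × (Y × Qubits k)) (X × Y) ℂ) (ρ : Matrix (X × Y) (X × Y) ℂ) :
    traceEbits ((LOCC.unitaryA V (.measureA n Q hQ fun m => .unitaryB (W m)
      (.measureB n' R hR fun s => .unitaryA (Z s) (P m s)))).run (K * ρ * Kᴴ)) =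
    ∑ m, ∑ s, traceEbits ((P m s).run
      (((Z s).1 ⊗ₖ (1 : Matrix (Y × Qubits k) (Y × Qubits k) ℂ)) *
      (((1 : Matrix (X × Qubits k) (X × Qubits k) ℂ) ⊗ₖ R s) *
      (((1 : Matrix (X × Qubits k) (X × Qubits k) ℂ) ⊗ₖ (W m).1) *
      ((Q m ⊗ₖ (1 : Matrix (Y × Qubits k) (Y × Qubits k) ℂ)) *
      ((V.1 ⊗ₖ (1 : Matrix (Y × Qubits k) (Y × Qubits k) ℂ)) * K)))) * ρ *
      (((Z s).1 ⊗ₖ (1 : Matrix (Y × Qubits k) (Y × Qubits k) ℂ)) *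
      (((1 : Matrix (X × Qubits k) (X × Qubits k) ℂ) ⊗ₖ R s) *
      (((1 : Matrix (X × Qubits k) (X × Qubits k) ℂ) ⊗ₖ (W m).1) *
      ((Q m ⊗ₖ (1 : Matrix (Y × Qubits k) (Y × Qubits k) ℂ)) *
      ((V.1 ⊗ₖ (1 : Matrix (Y × Qubits k) (Y × Qubits k) ℂ)) * K)))))ᴴ)) := by
  simp only [LOCC.run]
  rw [traceEbits_sum]
  refine Finset.sum_congr rfl fun m _ => ?_
  rw [traceEbits_sum]
  refine Finset.sum_congr rfl fun s _ => ?_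
  rw [conj_conj _ _ ρ, conj_conj _ _ ρ, conj_conj _ _ ρ, conj_conj _ _ ρ, conj_conj _ _ ρ]

/-- The continuation must work for every state in which the other ebits are intact, because the
registers it meets depend on the outcomes `m` and `s`. -/
lemma IsFresh.realizes_condRight {i : Fin k} {φ : Qubits k → Qubits k → ℂ} (h : IsFresh i φ)
    {p : Equiv.Perm (X × Y)} (hp : ∀ φ', (∀ j ≠ i, IsFresh j φ → IsFresh j φ') → Realizes φ' p)
    (q : X → Bool) (θ : Equiv.Perm Y) : Realizes φ (p * condRight q θ) := by
  choose P hP using fun m s =>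
    hp (measured i m s φ) fun j hj hf => isFresh_measured hj m s hf
  refine ⟨.unitaryA ⟨_, basisMap_mem_unitaryGroup (flipAt q i)⟩
    (.measureA 2 _ (isProjectiveMeasurement_computationalProj i) fun m =>
    .unitaryB ⟨_, basisMap_mem_unitaryGroup (condLeft (fun f => decide (f i ≠ m)) θ)⟩
    (.measureB 2 _ (isProjectiveMeasurement_conjugateProj i) fun s =>
    .unitaryA ⟨_, phase_mem_unitaryGroup q s⟩ (P m s))), fun ρ => ?_⟩
  rw [traceEbits_run_measure, ← h.sum_measured, Finset.sum_smul]
  refine Finset.sum_congr rfl fun m _ => ?_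
  rw [Finset.sum_smul]
  refine Finset.sum_congr rfl fun s _ => ?_
  rw [measured_protocol q θ h, ← conj_conj, hP, conj_conj, basisMap_mul, ← Equiv.Perm.coe_mul]

lemma IsFresh.swap {i : Fin k} {φ : Qubits k → Qubits k → ℂ} (h : IsFresh i φ) :
    IsFresh i fun e f => φ f e := by
  intro e f
  change φ f e = _
  rw [h f e]
  exact if_congr eq_comm rfl rfl

lemma IsFresh.realizes_condLeft {i : Fin k} {φ : Qubits k → Qubits k → ℂ} (h : IsFresh i φ)
    {p : Equiv.Perm (X × Y)} (hp : ∀ φ', (∀ j ≠ i, IsFresh j φ → IsFresh j φ') → Realizes φ' p)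
    (q : Y → Bool) (θ : Equiv.Perm X) : Realizes φ (p * condLeft q θ) := by
  have h1 := (h.swap.realizes_condRight (p := (Equiv.prodComm X Y).permCongr p)
    (fun φ' hφ' => (hp (fun e f => φ' f e) fun j hj hf => (hφ' j hj hf.swap).swap).swap) q θ).swap
  convert h1 using 1
  ext s : 1
  simp [Equiv.permCongr_apply, condLeft_apply, condRight_apply]

lemma Realizes.mulRight {φ : Qubits k → Qubits k → ℂ} {p : Equiv.Perm (X × Y)}
    (hp : Realizes φ p) (θ : Equiv.Perm Y) :
    Realizes φ (p * condRight (fun _ => true) θ) := by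
  obtain ⟨P, hP⟩ := hp
  refine ⟨.unitaryB ⟨_, basisMap_mem_unitaryGroup (condLeft (fun _ : Qubits k => true) θ)⟩ P,
    fun ρ => ?_⟩
  have h1 : ((1 : Matrix (X × Qubits k) (X × Qubits k) ℂ) ⊗ₖ
      basisMap (condLeft (fun _ : Qubits k => true) θ)) * adjoin X Y φ =
        adjoin X Y φ * basisMap (condRight (fun _ : X => true) θ) := by
    ext ⟨⟨x, e⟩, ⟨y, f⟩⟩ ⟨x', y'⟩
    rw [mul_basisMap_apply, one_kronecker_basisMap_mul_apply]
    simp [condLeft_inv_apply, condRight_apply, adjoin, Equiv.symm_apply_eq]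
  simp only [LOCC.run, conj_conj, h1]
  simp only [← conj_conj, hP]
  simp only [conj_conj, basisMap_mul, ← Equiv.Perm.coe_mul]

lemma Realizes.mulLeft {φ : Qubits k → Qubits k → ℂ} {p : Equiv.Perm (X × Y)}
    (hp : Realizes φ p) (θ : Equiv.Perm X) :
    Realizes φ (p * condLeft (fun _ => true) θ) := by
  convert (hp.swap.mulRight θ).swap using 1
  ext s : 1
  simp [Equiv.permCongr_apply, condLeft_apply, condRight_apply]

/-- A layered permutation consumes one ebit per layer. -/
lemma Layered.realizes {n : ℕ} {p : Equiv.Perm (X × Y)} (hp : Layered n p)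
    (φ : Qubits k → Qubits k → ℂ) (S : Finset (Fin k)) (hS : n ≤ S.card)
    (hφ : ∀ i ∈ S, IsFresh i φ) : Realizes φ p := by
  have pick : ∀ (n : ℕ) (S : Finset (Fin k)), n + 1 ≤ S.card → ∃ i ∈ S, n ≤ (S.erase i).card :=
      fun n S hn => by
    obtain ⟨i, hi⟩ := Finset.card_pos.1 (Nat.lt_of_lt_of_le n.succ_pos hn)
    exact ⟨i, hi, by rw [Finset.card_erase_of_mem hi]; omega⟩
  -- Both vary: each controlled layer uses up one index of `S` and changes the register state.
  induction hp generalizing φ S with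
  | one => exact realizes_one φ
  | mulLeft _ θ ih => exact (ih φ S hS hφ).mulLeft θ
  | mulRight _ θ ih => exact (ih φ S hS hφ).mulRight θ
  | mulCondLeft _ q θ ih =>
    obtain ⟨i, hi, hn⟩ := pick _ S hS
    exact (hφ i hi).realizes_condLeft (fun φ' hφ' => ih φ' (S.erase i) hn fun j hj =>
      hφ' j (Finset.ne_of_mem_erase hj) (hφ j (Finset.mem_of_mem_erase hj))) q θ
  | mulCondRight _ q θ ih =>
    obtain ⟨i, hi, hn⟩ := pick _ S hS
    exact (hφ i hi).realizes_condRight (fun φ' hφ' => ih φ' (S.erase i) hn fun j hj =>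
      hφ' j (Finset.ne_of_mem_erase hj) (hφ j (Finset.mem_of_mem_erase hj))) q θ

end Layers

/-! ### The state of `k` ebits as a vector -/

section Ebits

variable {k : ℕ}

/-- The state vector of `k` ebits. -/
noncomputable def ebitsVector (k : ℕ) : Qubits k → Qubits k → ℂ :=
  fun e f => if e = f then (((√2 : ℝ) : ℂ)⁻¹) ^ k else 0

lemma inv_sqrt_two_pow_mul_star (k : ℕ) :
    (((√2 : ℝ) : ℂ)⁻¹) ^ k * star ((((√2 : ℝ) : ℂ)⁻¹) ^ k) = (1 / 2) ^ k := by
  have h : (((√2 : ℝ) : ℂ)⁻¹) * (((√2 : ℝ) : ℂ)⁻¹) = 1 / 2 := by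
    rw [← mul_inv, ← Complex.ofReal_mul, Real.mul_self_sqrt (by norm_num)]
    norm_num
  rw [star_pow, ← mul_pow, Complex.star_def, map_inv₀, Complex.conj_ofReal, h]

lemma isFresh_ebitsVector (i : Fin k) : IsFresh i (ebitsVector k) := by
  intro e f
  by_cases h : e i = f i
  · rw [if_pos h]
    refine if_congr ⟨fun hef => by rw [hef], fun hef => ?_⟩ rfl rfl
    ext j : 1
    by_cases hj : j = i
    · rw [hj, h]
    · simpa [hj] using congrFun hef j
  · rw [if_neg h]
    exact if_neg fun hef => h (by rw [hef])

lemma sum_ebitsVector : ∑ e, ∑ f, ebitsVector k e f * star (ebitsVector k e f) = 1 := by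
  have h : ∀ e f : Qubits k, ebitsVector k e f * star (ebitsVector k e f) =
      if e = f then (1 / 2) ^ k else 0 := by
    intro e f
    rw [← inv_sqrt_two_pow_mul_star]
    unfold ebitsVector
    split_ifs <;> simp
  simp only [h, Finset.sum_ite_eq, Finset.mem_univ, if_true]
  simp

lemma ebits_apply (e f e' f' : Qubits k) :
    ebits k (e, f) (e', f') = ebitsVector k e f * star (ebitsVector k e' f') := by
  have h : ebits k (e, f) (e', f') = if e = f ∧ e' = f' then (1 / 2) ^ k else 0 := by
    simp only [ebits, ebit, Matrix.of_apply]
    split_ifs with h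
    · obtain ⟨rfl, rfl⟩ := h
      simp
    · rw [Finset.prod_eq_zero_iff]
      by_contra! h'
      refine h ⟨funext fun i => ?_, funext fun i => ?_⟩
      · exact (ite_ne_right_iff.1 (h' i (Finset.mem_univ i))).1.1
      · exact (ite_ne_right_iff.1 (h' i (Finset.mem_univ i))).1.2
  rw [h, ← inv_sqrt_two_pow_mul_star]
  unfold ebitsVector
  by_cases h1 : e = f <;> by_cases h2 : e' = f' <;> simp [h1, h2]

lemma addEbits_eq {X Y : Type} [Fintype X] [DecidableEq X] [Fintype Y] [DecidableEq Y]
    (ρ : Matrix (X × Y) (X × Y) ℂ) :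
    addEbits k ρ = adjoin X Y (ebitsVector k) * ρ * (adjoin X Y (ebitsVector k))ᴴ := by
  ext s t
  rw [adjoin_conj_apply]
  simp only [addEbits, Matrix.of_apply, ebits_apply]
  ring

end Ebits

/-! ### Ancillas and the LOCC implementation -/

section Main

variable {dA dB mA mB : ℕ}

/-- Adjoin ancilla qubits in the state `|0⟩`. -/
def ancillaIsometry (dA dB mA mB : ℕ) :
    Matrix (Party dA mA × Party dB mB) (Fin dA × Fin dB) ℂ :=
  Matrix.of fun s t => if s = ((t.1, 0), (t.2, 0)) then 1 else 0

lemma withAncillasState_eq (ρ : Matrix (Fin dA × Fin dB) (Fin dA × Fin dB) ℂ) :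
    withAncillasState mA mB ρ =
      ancillaIsometry dA dB mA mB * ρ * (ancillaIsometry dA dB mA mB)ᴴ := by
  ext ⟨⟨a, e⟩, ⟨b, f⟩⟩ ⟨⟨a', e'⟩, ⟨b', f'⟩⟩
  simp only [withAncillasState, ancillaIsometry, Matrix.mul_apply, Matrix.of_apply,
    Matrix.conjTranspose_apply, Fintype.sum_prod_type, Prod.mk.injEq]
  by_cases he : e = 0 <;> by_cases hf : f = 0 <;> by_cases he' : e' = 0 <;>
    by_cases hf' : f' = 0 <;> simp [he, hf, he', hf', ite_and, apply_ite]

/-- A layered permutation that restores the ancilla qubits is implemented by LOCC and one ebit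
per layer. -/
lemma Layered.implementedByLOCC {n N : ℕ} {p : Equiv.Perm (Party dA mA × Party dB mB)}
    (hp : Layered n p) {g : Equiv.Perm (Fin dA × Fin dB)}
    (hg : ∀ a b, p ((a, 0), (b, 0)) = (((g (a, b)).1, 0), ((g (a, b)).2, 0)))
    (hN : n ≤ N) : ImplementedByLOCC (basisMap g) mA mB N := by
  obtain ⟨P, hP⟩ := hp.realizes (ebitsVector n) Finset.univ (by simp)
    fun i _ => isFresh_ebitsVector i
  refine ⟨n, hN, P, fun ρ => ?_⟩
  -- `p` acts as `g` on the subspace with ancillas in zero, so it intertwines with adjoining them.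
  have h : basisMap p * ancillaIsometry dA dB mA mB =
      ancillaIsometry dA dB mA mB * basisMap g := by
    ext s t
    rw [mul_basisMap_apply]
    simp only [Matrix.mul_apply, basisMap, ancillaIsometry, Matrix.of_apply, mul_ite, mul_one,
      mul_zero, Finset.sum_ite_eq', Finset.mem_univ, if_true, hg]
  rw [addEbits_eq, hP, sum_ebitsVector, one_smul, withAncillasState_eq, conj_conj _ _ ρ, h,
    ← conj_conj, ← withAncillasState_eq]

end Main

end BipartiteCost

theorem theorem3 (dA dB r : ℕ) (U : Matrix (Fin dA × Fin dB) (Fin dA × Fin dB) ℂ)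
    (hU : BipartiteCost.IsPermutationUnitary U) (hr : BipartiteCost.HasSchmidtRank U r) :
    (BipartiteCost.ImplementedByCNOTs U 1 2 (6 * BipartiteCost.costBound dA dB r) ∧
      BipartiteCost.ImplementedByCNOTs U 2 1 (6 * BipartiteCost.costBound dA dB r)) ∧
    (BipartiteCost.ImplementedByLOCC U 1 0 (3 * BipartiteCost.costBound dA dB r) ∧
      BipartiteCost.ImplementedByLOCC U 0 1 (3 * BipartiteCost.costBound dA dB r)) := by
  obtain ⟨σ, rfl⟩ := hU
  obtain ⟨A, B, -, -, hAB⟩ := hr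
  rw [BipartiteCost.permMatrix_eq_basisMap] at hAB ⊢
  have h : ∀ s t, (if s = σ⁻¹ t then 1 else 0 : ℂ) = ∑ l, A l s.1 t.1 * B l s.2 t.2 := by
    intro s t
    simpa [BipartiteCost.basisMap, Matrix.sum_apply, Matrix.kroneckerMap_apply] using
      congrFun (congrFun hAB s) t
  obtain ⟨n, hn, p, hp, hg⟩ := BipartiteCost.exists_layered_of_schmidtRank h
  obtain ⟨n', hn', p', hp', hg'⟩ := BipartiteCost.exists_layered_of_schmidtRank' h
  -- `p` has its flag at the second party and `p'` at the first. The CNOT circuits add one carrier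
  -- qubit at each party; the LOCC protocols need the flag only.
  exact ⟨⟨hp.implementedByCNOTs hg (by omega), hp'.implementedByCNOTs hg' (by omega)⟩,
    hp'.implementedByLOCC hg' hn', hp.implementedByLOCC hg hn⟩
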